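/- Let $d\in\{1,2,3\}$, let $D\subset\mathbb R^d$ be a bounded domain that has a smooth boundary or is a convex polyhedron, let $T>0$, $\alpha\ge 0$, $\beta\in\mathbb R$, $\tau_0\in(0,1)$, and write $\|\cdot\|$, $(\cdot,\cdot)$ for the norm and inner product of $\mathbb L^2=L^2(D)$. Assume (H): there is $\mathcal C_0>0$ with $\|\nabla\varphi\|^2-\frac{\beta^2}{2}\|\varphi\|^2\ge \mathcal C_0\|\varphi\|^2$ for all $\varphi\in H^1_0(D)$. For a conforming triangulation $\mathcal T_h$ of $D$ into simplices with maximal diameter $h$ (covering $\overline D$ if $D$ is a convex polyhedron; otherwise contained in $\overline D$ and leaving uncovered at most a boundary layer of width $h$, on which finite element functions vanish), let $\mathbb V_h\subset H^1_0(D)$ be the space of functions that are affine on every element, $\Pi_h:\mathbb L^2\to\mathbb V_h$ the $\mathbb L^2$-projection, $\Delta_h:\mathbb V_h\to\mathbb V_h$ the discrete Laplacian, $(-\Delta_h\varphi,\psi)=(\nabla\varphi,\nabla\psi)$ for $\varphi,\psi\in\mathbb V_h$, and $\mathcal A_h=\Delta_h+\frac{\beta^2}{2}\mathbb 1_h$.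 For an integer $N\ge1$ put $\tau=T/N$, $t_n=n\tau$, $\mathcal A_0=(\mathbb 1_h-\tau\mathcal A_h)^{-1}$. Let $\mathcal P_h(\cdot)$ denote a solution on $[0,T]$, with values in $\mathcal L(\mathbb V_h)$, of $$\mathcal P_h'(t)+\mathcal A_h\mathcal P_h(t)+\mathcal P_h(t)\mathcal A_h+\mathbb 1_h-\mathcal P_h(t)^2=0,\qquad \mathcal P_h(T)=\alpha\mathbb 1_h,$$ and consider the difference Riccati equation, for $n=0,\dots,N-1$, $$\mathcal P_n=\mathcal A_0\mathcal P_{n+1}\mathcal A_0+\tau\mathbb 1_h-\tau\mathcal H_n\mathcal K_n^{-1}\mathcal H_n,\quad \mathcal P_N=\alpha\mathbb 1_h,\quad \mathcal H_n=\mathcal A_0\mathcal P_{n+1}\mathcal A_0,\quad \mathcal K_n=\mathbb 1_h+\tau\mathcal A_0\mathcal P_{n+1}\mathcal A_0 .$$ For $0\le l<N$, $z\in\mathbb L^2$ and controls $u_l,\dots,u_{N-1}\in\mathbb L^2$ let $x_l=\Pi_hz$, $x_{n+1}=\mathcal A_0x_n+\tau\mathcal A_0\Pi_hu_n$, and $$\mathcal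 G_{h,\tau}(t_l,z;u)=\tfrac12\Big[\tau\sum_{n=l}^{N-1}\|x_n\|^2+\tau\sum_{n=l}^{N-1}\|u_n\|^2\Big]+\tfrac\alpha2\|x_N\|^2,\qquad V_{h,\tau}(t_l,z)=\inf_u\mathcal G_{h,\tau}(t_l,z;u).$$ (1) For all $\mathcal T_h$ and $N$, the operator $\mathbb 1_h-\tau\mathcal A_h$ is invertible, the difference Riccati equation has a solution, and for every solution $(\mathcal P_n)_{n=0}^N$ all $\mathcal P_n$ are symmetric and nonnegative on $\mathbb V_h$ and all $\mathcal K_n$ are invertible. For all $0\le l<N$ and $z\in\mathbb L^2$ the problem of minimizing $\mathcal G_{h,\tau}(t_l,z;\cdot)$ has a unique solution $u^*$, it satisfies $u^*_n=-\mathcal K_n^{-1}\mathcal H_nx^*_n$ for $n=l,\dots,N-1$, where $x^*$ is the state belonging to $u^*$, and $V_{h,\tau}(t_l,z)=\frac12(\mathcal P_l\Pi_hz,z)$. (2) There is a constant $\mathcal C>0$, independent of $h$, $\mathcal T_h$ and $\tau$, such that for all $\mathcal T_h$, all $N$ with $\tau=T/N\le\tau_0$, and all $l=0,\dots,N-1$,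 $$\|\mathcal P_h(t_l)\Pi_h-\mathcal P_l\Pi_h\|_{\mathcal L(\mathbb L^2)}\le \mathcal C\,\tau\Big[\frac{\alpha}{T-t_l}+\ln\frac1\tau\Big].$$ -/

import Mathlib

open MeasureTheory Set
open scoped ContDiff RealInnerProductSpace

noncomputable section

/-! ### Domains -/

/-- The Euclidean space `ℝ^d`. -/
abbrev Euc (d : ℕ) := EuclideanSpace ℝ (Fin d)

/-- A bounded domain: bounded, open, connected and nonempty. -/
structure IsBoundedDomain {d : ℕ} (D : Set (Euc d)) : Prop where
  isOpen : IsOpen D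
  isConnected : IsConnected D
  isBounded : Bornology.IsBounded D

/-- The boundary is smooth: near each boundary point, `D` is the sublevel set `{ρ < 0}` of a
smooth function with nonvanishing differential. -/
def HasSmoothBoundary {d : ℕ} (D : Set (Euc d)) : Prop :=
  ∀ x ∈ frontier D, ∃ (U : Set (Euc d)) (ρ : Euc d → ℝ), IsOpen U ∧ x ∈ U ∧ ContDiff ℝ ∞ ρ ∧
    fderiv ℝ ρ x ≠ 0 ∧ D ∩ U = {y | ρ y < 0} ∩ U

/-- `D` is an (open) convex polyhedron. -/
def IsConvexPolyhedral {d : ℕ} (D : Set (Euc d)) : Prop :=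
  ∃ s : Finset (Euc d), D = interior (convexHull ℝ (s : Set (Euc d)))

/-! ### `L²(D)`, `H¹₀(D)` and the gradient -/

/-- `L²(D)`. -/
abbrev L2 {d : ℕ} (D : Set (Euc d)) := Lp ℝ 2 (volume.restrict D)

/-- `L²(D; ℝ^d)`. -/
abbrev L2V {d : ℕ} (D : Set (Euc d)) := Lp (Euc d) 2 (volume.restrict D)

/-- The pairs `(φ, ∇φ)` with `φ ∈ C_c^∞(D)`. -/
def testGraph {d : ℕ} (D : Set (Euc d)) : Submodule ℝ (L2 D × L2V D) where
  carrier := {p | ∃ φ : Euc d → ℝ, ContDiff ℝ ∞ φ ∧ HasCompactSupport φ ∧ tsupport φ ⊆ D ∧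
    p.1 =ᵐ[volume.restrict D] φ ∧ p.2 =ᵐ[volume.restrict D] gradient φ}
  zero_mem' := by
    refine ⟨fun _ => 0, contDiff_const, HasCompactSupport.zero, ?_, Lp.coeFn_zero _ _ _, ?_⟩
    · simp [tsupport]
    · have h : gradient (fun _ : Euc d => (0 : ℝ)) = 0 := by
        funext x; simp
      rw [h]; exact Lp.coeFn_zero _ _ _
  add_mem' := by
    rintro p q ⟨φ, hφ, hφc, hφD, hφ1, hφ2⟩ ⟨ψ, hψ, hψc, hψD, hψ1, hψ2⟩
    refine ⟨φ + ψ, hφ.add hψ, hφc.add hψc, ?_, ?_, ?_⟩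
    · exact (tsupport_add φ ψ).trans (union_subset hφD hψD)
    · exact (Lp.coeFn_add _ _).trans (hφ1.add hψ1)
    · refine (Lp.coeFn_add _ _).trans ((hφ2.add hψ2).trans (Filter.Eventually.of_forall ?_))
      intro x
      simp only [Pi.add_apply, gradient]
      rw [fderiv_add (hφ.differentiable (by simp) x) (hψ.differentiable (by simp) x), map_add]
  smul_mem' := by
    rintro c p ⟨φ, hφ, hφc, hφD, hφ1, hφ2⟩
    refine ⟨c • φ, hφ.const_smul c, hφc.smul_left (f := fun _ => c), ?_, ?_, ?_⟩
    · exact (tsupport_smul_subset_right (fun _ => c) φ).trans hφD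
    · exact (Lp.coeFn_smul _ _).trans (hφ1.const_smul c)
    · refine (Lp.coeFn_smul _ _).trans ((hφ2.const_smul c).trans (Filter.Eventually.of_forall ?_))
      intro x
      simp only [Pi.smul_apply, gradient]
      rw [fderiv_const_smul (hφ.differentiable (by simp) x), map_smul]

/-- The weak gradient with domain `H¹₀(D)`: its graph is the closure of
`{(φ, ∇φ) : φ ∈ C_c^∞(D)}` in `L²(D) × L²(D; ℝ^d)`. -/
def gradD {d : ℕ} (D : Set (Euc d)) : L2 D →ₗ.[ℝ] L2V D :=
  (testGraph D).topologicalClosure.toLinearPMap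

/-- The Sobolev space `H¹₀(D)`, the closure of `C_c^∞(D)` in the `H¹` norm. -/
def H01 {d : ℕ} (D : Set (Euc d)) : Submodule ℝ (L2 D) := (gradD D).domain

/-- Integration by parts against a test function. -/
theorem testGraph_closure_inner {d : ℕ} {D : Set (Euc d)}
    {p : L2 D × L2V D} (hp : p ∈ (testGraph D).topologicalClosure)
    {ψ : Euc d → ℝ} (hψ : ContDiff ℝ ∞ ψ) (hψc : HasCompactSupport ψ) (hψD : tsupport ψ ⊆ D)
    (v : Euc d) (F : L2V D) (hF : F =ᵐ[volume.restrict D] fun x => ψ x • v)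
    (G : L2 D) (hG : G =ᵐ[volume.restrict D] fun x => fderiv ℝ ψ x v) :
    ⟪F, p.2⟫ = - ⟪G, p.1⟫ := by
  have hclosed : IsClosed {q : L2 D × L2V D | ⟪F, q.2⟫ = - ⟪G, q.1⟫} :=
    isClosed_eq (by fun_prop) (by fun_prop)
  refine closure_minimal (s := (testGraph D : Set (L2 D × L2V D))) ?_ hclosed hp
  rintro ⟨u, g⟩ ⟨φ, hφ, hφc, hφD, hu, hg⟩
  simp only [mem_ofPred_eq] at hu hg ⊢
  rw [L2.inner_def, L2.inner_def]
  have e1 : ∫ x in D, ⟪F x, g x⟫ = ∫ x in D, ψ x * fderiv ℝ φ x v := by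
    apply integral_congr_ae
    filter_upwards [hF, hg] with x h1 h2
    rw [h1, h2, real_inner_smul_left, real_inner_comm, gradient,
      InnerProductSpace.toDual_symm_apply]
  have e2 : ∫ x in D, ⟪G x, u x⟫ = ∫ x in D, fderiv ℝ ψ x v * φ x := by
    apply integral_congr_ae
    filter_upwards [hG, hu] with x h1 h2
    rw [h1, h2]
    simp [mul_comm]
  rw [e1, e2]
  have hψ0 : ∀ x, x ∉ D → ψ x = 0 := fun x hx => image_eq_zero_of_notMem_tsupport
    (fun h => hx (hψD h))
  have hφ0 : ∀ x, x ∉ D → φ x = 0 := fun x hx => image_eq_zero_of_notMem_tsupport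
    (fun h => hx (hφD h))
  rw [setIntegral_eq_integral_of_forall_compl_eq_zero (fun x hx => by simp [hψ0 x hx]),
    setIntegral_eq_integral_of_forall_compl_eq_zero (fun x hx => by simp [hφ0 x hx])]
  have cψ : Continuous ψ := hψ.continuous
  have cφ : Continuous φ := hφ.continuous
  have cdψ : Continuous fun x => fderiv ℝ ψ x v := (hψ.continuous_fderiv (by simp)).clm_apply
    continuous_const
  have cdφ : Continuous fun x => fderiv ℝ φ x v := (hφ.continuous_fderiv (by simp)).clm_apply
    continuous_const
  apply integral_mul_fderiv_eq_neg_fderiv_mul_of_integrable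
  · exact (cdψ.mul cφ).integrable_of_hasCompactSupport hφc.mul_left
  · exact (cψ.mul cdφ).integrable_of_hasCompactSupport hψc.mul_right
  · exact (cψ.mul cφ).integrable_of_hasCompactSupport hφc.mul_left
  · exact fun x _ => hψ.differentiable (by simp) x
  · exact fun x _ => hφ.differentiable (by simp) x

/-- Uniqueness of the weak gradient. -/
theorem snd_eq_zero_of_mem_testGraph_closure {d : ℕ} {D : Set (Euc d)} (hD : IsOpen D)
    (p : L2 D × L2V D) (hp : p ∈ (testGraph D).topologicalClosure) (h0 : p.1 = 0) :
    p.2 = 0 := by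
  have key : ∀ᵐ x ∂(volume.restrict D), x ∈ D → p.2 x = 0 := by
    apply hD.ae_eq_zero_of_integral_contDiff_smul_eq_zero
    · exact ((Lp.memLp p.2).locallyIntegrable (by norm_num)).locallyIntegrableOn D
    intro ψ hψ hψc hψD
    have hmem : MemLp ψ 2 (volume.restrict D) :=
      (hψ.continuous.memLp_of_hasCompactSupport hψc)
    have hint : Integrable (fun x => ψ x • p.2 x) (volume.restrict D) := by
      exact memLp_one_iff_integrable.1 ((Lp.memLp p.2).smul hmem)
    apply ext_inner_left ℝ
    intro v
    rw [inner_zero_right, ← integral_inner hint v]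
    have m1 : MemLp (fun x => ψ x • v) 2 (volume.restrict D) :=
      (hψ.continuous.smul continuous_const).memLp_of_hasCompactSupport hψc.smul_right
    have m2 : MemLp (fun x => fderiv ℝ ψ x v) 2 (volume.restrict D) :=
      ((hψ.continuous_fderiv (by simp)).clm_apply
        continuous_const).memLp_of_hasCompactSupport (hψc.fderiv_apply ℝ v)
    have h := testGraph_closure_inner hp hψ hψc hψD v m1.toLp m1.coeFn_toLp m2.toLp m2.coeFn_toLp
    rw [h0, inner_zero_right, neg_zero, L2.inner_def] at h
    rw [← h]
    apply integral_congr_ae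
    filter_upwards [m1.coeFn_toLp] with x hx
    rw [hx, real_inner_smul_left, real_inner_smul_right]
  have hmeas : ∀ᵐ x ∂(volume.restrict D), x ∈ D := ae_restrict_mem hD.measurableSet
  rw [Lp.eq_zero_iff_ae_eq_zero]
  filter_upwards [key, hmeas] with x h1 h2 using h1 h2

/-- The graph of the gradient on `H¹₀(D)`. -/
theorem gradD_graph {d : ℕ} {D : Set (Euc d)} (hD : IsOpen D) :
    (gradD D).graph = (testGraph D).topologicalClosure :=
  Submodule.toLinearPMap_graph_eq _ (snd_eq_zero_of_mem_testGraph_closure hD)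

/-- The coercivity assumption (H): `‖∇φ‖² - (β²/2) ‖φ‖² ≥ C₀ ‖φ‖²` on `H¹₀(D)`. -/
def AssumptionH {d : ℕ} (D : Set (Euc d)) (β : ℝ) : Prop :=
  ∃ C₀ : ℝ, 0 < C₀ ∧ ∀ φ : (gradD D).domain,
    C₀ * ‖(φ : L2 D)‖ ^ 2 ≤ ‖gradD D φ‖ ^ 2 - β ^ 2 / 2 * ‖(φ : L2 D)‖ ^ 2

/-! ### Finite elements -/

/-- A conforming triangulation of `D` into `d`-simplices with maximal diameter `h`. It covers
`closure D` if `D` is a convex polyhedron; in general the part of `D` left uncovered at a curved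
boundary has width at most `h`. -/
structure Triangulation {d : ℕ} (D : Set (Euc d)) (h : ℝ) where
  /-- the underlying simplicial complex -/
  complex : Geometry.SimplicialComplex ℝ (Euc d)
  finite_faces : complex.faces.Finite
  /-- every face is a face of some element, a simplex with `d + 1` vertices -/
  pure : ∀ s ∈ complex.faces, ∃ t ∈ complex.faces, s ⊆ t ∧ t.card = d + 1
  space_subset : complex.space ⊆ closure D
  covers : IsConvexPolyhedral D → closure D ⊆ complex.space
  skin : ∀ x ∈ D, x ∉ complex.space → Metric.infDist x (frontier D) ≤ h
  isGreatest_diam : IsGreatest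
    {r | ∃ t ∈ complex.faces, t.card = d + 1 ∧ r = Metric.diam (convexHull ℝ (t : Set (Euc d)))} h

/-- The index type of the elements of a triangulation. -/
abbrev Triangulation.Element {d : ℕ} {D : Set (Euc d)} {h : ℝ} (𝒯 : Triangulation D h) :=
  {t : Finset (Euc d) // t ∈ 𝒯.complex.faces ∧ t.card = d + 1}

instance {d : ℕ} {D : Set (Euc d)} {h : ℝ} (𝒯 : Triangulation D h) : Finite 𝒯.Element :=
  (𝒯.finite_faces.subset (fun _ ht => ht.1) :
    {t | t ∈ 𝒯.complex.faces ∧ t.card = d + 1}.Finite).to_subtype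

/-- Pairs of a function on `D` and a family of affine functions `x ↦ ⟪w K, x⟫ + c K` with which
it agrees on the elements `K`; the function vanishes outside the triangulation. -/
def piecewiseAffine {d : ℕ} {D : Set (Euc d)} {h : ℝ} (𝒯 : Triangulation D h) :
    Submodule ℝ (L2 D × (𝒯.Element → Euc d × ℝ)) where
  carrier := {p | (∀ K : 𝒯.Element, ∀ᵐ x ∂(volume.restrict D),
      x ∈ convexHull ℝ (K.1 : Set (Euc d)) → p.1 x = ⟪(p.2 K).1, x⟫ + (p.2 K).2) ∧
    ∀ᵐ x ∂(volume.restrict D), x ∉ 𝒯.complex.space → p.1 x = 0}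
  zero_mem' := by
    have h0 := Lp.coeFn_zero ℝ 2 (volume.restrict D)
    refine ⟨fun K => ?_, ?_⟩
    · filter_upwards [h0] with x hx _
      simpa using hx
    · filter_upwards [h0] with x hx _
      simpa using hx
  add_mem' := by
    rintro p q ⟨hp, hp'⟩ ⟨hq, hq'⟩
    have ha := Lp.coeFn_add p.1 q.1
    refine ⟨fun K => ?_, ?_⟩
    · filter_upwards [ha, hp K, hq K] with x hx h1 h2 hK
      simp only [Prod.fst_add, Prod.snd_add, Pi.add_apply, inner_add_left] at hx ⊢
      rw [hx, h1 hK, h2 hK]; ring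
    · filter_upwards [ha, hp', hq'] with x hx h1 h2 hK
      simp only [Prod.fst_add, Pi.add_apply] at hx ⊢
      rw [hx, h1 hK, h2 hK, add_zero]
  smul_mem' := by
    rintro c p ⟨hp, hp'⟩
    have ha := Lp.coeFn_smul c p.1
    refine ⟨fun K => ?_, ?_⟩
    · filter_upwards [ha, hp K] with x hx h1 hK
      simp only [Prod.smul_fst, Prod.smul_snd, Pi.smul_apply, real_inner_smul_left,
        smul_eq_mul] at hx ⊢
      rw [hx, h1 hK]; ring
    · filter_upwards [ha, hp'] with x hx h1 hK
      simp only [Prod.smul_fst, Pi.smul_apply, smul_eq_mul] at hx ⊢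
      rw [hx, h1 hK, mul_zero]

/-- The finite element space `𝕍_h`: the functions in `H¹₀(D)` that are affine on each element. -/
def femSpace {d : ℕ} {D : Set (Euc d)} {h : ℝ} (𝒯 : Triangulation D h) : Submodule ℝ (L2 D) :=
  H01 D ⊓ (piecewiseAffine 𝒯).map (LinearMap.fst ℝ _ _)

theorem piecewiseAffine_fst_eq_zero {d : ℕ} {D : Set (Euc d)} {h : ℝ} (𝒯 : Triangulation D h)
    {p : L2 D × (𝒯.Element → Euc d × ℝ)} (hp : p ∈ piecewiseAffine 𝒯) (h0 : p.2 = 0) :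
    p.1 = 0 := by
  obtain ⟨h1, h2⟩ := hp
  rw [Lp.eq_zero_iff_ae_eq_zero]
  filter_upwards [ae_all_iff.2 h1, h2] with x hx hx'
  by_cases hs : x ∈ 𝒯.complex.space
  · obtain ⟨s, hs, hxs⟩ := Geometry.SimplicialComplex.mem_space_iff.1 hs
    obtain ⟨t, ht, hst, hc⟩ := 𝒯.pure s hs
    have := hx ⟨t, ht, hc⟩ (convexHull_mono (by exact_mod_cast hst) hxs)
    simpa [h0] using this
  · simpa using hx' hs

instance {d : ℕ} {D : Set (Euc d)} {h : ℝ} (𝒯 : Triangulation D h) :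
    FiniteDimensional ℝ (femSpace 𝒯) := by
  have inj : Function.Injective
      ((LinearMap.snd ℝ (L2 D) (𝒯.Element → Euc d × ℝ)).comp (piecewiseAffine 𝒯).subtype) := by
    rw [injective_iff_map_eq_zero]
    rintro ⟨p, hp⟩ h0
    have h2 : p.2 = 0 := h0
    exact Subtype.ext (Prod.ext (piecewiseAffine_fst_eq_zero 𝒯 hp h2) h2)
  have : FiniteDimensional ℝ (piecewiseAffine 𝒯) := FiniteDimensional.of_injective _ inj
  exact Submodule.finiteDimensional_of_le
    (inf_le_right : femSpace 𝒯 ≤ (piecewiseAffine 𝒯).map (LinearMap.fst ℝ _ _))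

/-- The gradient on `𝕍_h`. -/
def gradh {d : ℕ} {D : Set (Euc d)} {h : ℝ} (𝒯 : Triangulation D h) :
    femSpace 𝒯 →L[ℝ] L2V D :=
  LinearMap.toContinuousLinearMap ((gradD D).toFun.comp
    (Submodule.inclusion (inf_le_left : femSpace 𝒯 ≤ H01 D)))

/-- The discrete Laplacian `Δ_h : 𝕍_h → 𝕍_h`; see `inner_neg_discreteLaplacian`. -/
def discreteLaplacian {d : ℕ} {D : Set (Euc d)} {h : ℝ} (𝒯 : Triangulation D h) :
    femSpace 𝒯 →L[ℝ] femSpace 𝒯 :=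
  -((ContinuousLinearMap.adjoint (gradh 𝒯)).comp (gradh 𝒯))

/-- The defining identity `(-Δ_h φ, ψ) = (∇φ, ∇ψ)` of the discrete Laplacian. -/
theorem inner_neg_discreteLaplacian {d : ℕ} {D : Set (Euc d)} {h : ℝ} (𝒯 : Triangulation D h)
    (φ ψ : femSpace 𝒯) :
    ⟪-discreteLaplacian 𝒯 φ, ψ⟫ = ⟪gradh 𝒯 φ, gradh 𝒯 ψ⟫ := by
  simp [discreteLaplacian, ContinuousLinearMap.adjoint_inner_left]

/-- The `L²`-projection `Π_h : L²(D) → 𝕍_h`. -/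
def projh {d : ℕ} {D : Set (Euc d)} {h : ℝ} (𝒯 : Triangulation D h) : L2 D →L[ℝ] femSpace 𝒯 :=
  (femSpace 𝒯).orthogonalProjectionOnto

/-- `𝒜_h = Δ_h + (β²/2) 1`. -/
def shiftedLaplacian {d : ℕ} {D : Set (Euc d)} {h : ℝ} (𝒯 : Triangulation D h) (β : ℝ) :
    femSpace 𝒯 →L[ℝ] femSpace 𝒯 :=
  discreteLaplacian 𝒯 + (β ^ 2 / 2) • 1

/-- `𝒜₀ = (1 - τ 𝒜_h)⁻¹`. -/
def resolvent₀ {d : ℕ} {D : Set (Euc d)} {h : ℝ} (𝒯 : Triangulation D h) (β τ : ℝ) :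
    femSpace 𝒯 →L[ℝ] femSpace 𝒯 :=
  Ring.inverse (1 - τ • shiftedLaplacian 𝒯 β)

/-! ### The Riccati equations -/

/-- `P` solves `P' + 𝒜_h P + P 𝒜_h + 1 - P² = 0` on `[0, T]`, `P(T) = α 1`. -/
def IsRiccatiSolution {d : ℕ} {D : Set (Euc d)} {h : ℝ} (𝒯 : Triangulation D h) (T α β : ℝ)
    (P : ℝ → femSpace 𝒯 →L[ℝ] femSpace 𝒯) : Prop :=
  (∀ t ∈ Icc 0 T, HasDerivWithinAt P
    (-(shiftedLaplacian 𝒯 β * P t + P t * shiftedLaplacian 𝒯 β + 1 - P t ^ 2)) (Icc 0 T) t) ∧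
  P T = α • 1

/-- `ℋ_n = 𝒜₀ P_{n+1} 𝒜₀`. -/
def opH {d : ℕ} {D : Set (Euc d)} {h : ℝ} (𝒯 : Triangulation D h) (β τ : ℝ)
    (P : ℕ → femSpace 𝒯 →L[ℝ] femSpace 𝒯) (n : ℕ) : femSpace 𝒯 →L[ℝ] femSpace 𝒯 :=
  resolvent₀ 𝒯 β τ * P (n + 1) * resolvent₀ 𝒯 β τ

/-- `𝒦_n = 1 + τ 𝒜₀ P_{n+1} 𝒜₀`. -/
def opK {d : ℕ} {D : Set (Euc d)} {h : ℝ} (𝒯 : Triangulation D h) (β τ : ℝ)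
    (P : ℕ → femSpace 𝒯 →L[ℝ] femSpace 𝒯) (n : ℕ) : femSpace 𝒯 →L[ℝ] femSpace 𝒯 :=
  1 + τ • (resolvent₀ 𝒯 β τ * P (n + 1) * resolvent₀ 𝒯 β τ)

/-- `(P_n)_{n ≤ N}` solves the difference Riccati equation
`P_n = 𝒜₀ P_{n+1} 𝒜₀ + τ 1 - τ ℋ_n 𝒦_n⁻¹ ℋ_n`, `P_N = α 1`. -/
def IsDifferenceRiccatiSolution {d : ℕ} {D : Set (Euc d)} {h : ℝ} (𝒯 : Triangulation D h)
    (α β τ : ℝ) (N : ℕ) (P : ℕ → femSpace 𝒯 →L[ℝ] femSpace 𝒯) : Prop :=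
  (∀ n < N, P n = resolvent₀ 𝒯 β τ * P (n + 1) * resolvent₀ 𝒯 β τ + τ • 1
    - τ • (opH 𝒯 β τ P n * Ring.inverse (opK 𝒯 β τ P n) * opH 𝒯 β τ P n)) ∧
  P N = α • 1

/-! ### The discretized auxiliary LQ problem -/

/-- The discrete state, counted from the initial index `l`: `dstateFrom k` is the state at index
`l + k`. -/
def dstateFrom {d : ℕ} {D : Set (Euc d)} {h : ℝ} (𝒯 : Triangulation D h) (β τ : ℝ) (l : ℕ)
    (z : L2 D) (u : ℕ → L2 D) : ℕ → femSpace 𝒯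
  | 0 => projh 𝒯 z
  | k + 1 => resolvent₀ 𝒯 β τ (dstateFrom 𝒯 β τ l z u k)
      + τ • resolvent₀ 𝒯 β τ (projh 𝒯 (u (l + k)))

/-- The discrete state `x_n(t_l, z, u)`, `n ≥ l`: `x_l = Π_h z`,
`x_{n+1} = 𝒜₀ x_n + τ 𝒜₀ Π_h u_n`. -/
def dstate {d : ℕ} {D : Set (Euc d)} {h : ℝ} (𝒯 : Triangulation D h) (β τ : ℝ) (l : ℕ)
    (z : L2 D) (u : ℕ → L2 D) (n : ℕ) : femSpace 𝒯 :=
  dstateFrom 𝒯 β τ l z u (n - l)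

/-- The discrete cost functional; only the controls `u_n`, `l ≤ n < N`, matter. -/
def dcost {d : ℕ} {D : Set (Euc d)} {h : ℝ} (𝒯 : Triangulation D h) (α β τ : ℝ) (N l : ℕ)
    (z : L2 D) (u : ℕ → L2 D) : ℝ :=
  1 / 2 * (τ * ∑ n ∈ Finset.Ico l N, ‖dstate 𝒯 β τ l z u n‖ ^ 2
    + τ * ∑ n ∈ Finset.Ico l N, ‖u n‖ ^ 2)
    + α / 2 * ‖dstate 𝒯 β τ l z u N‖ ^ 2

/-- `u` is an optimal control of the discrete LQ problem started at `(t_l, z)`. -/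
def IsOptimalControl {d : ℕ} {D : Set (Euc d)} {h : ℝ} (𝒯 : Triangulation D h) (α β τ : ℝ)
    (N l : ℕ) (z : L2 D) (u : ℕ → L2 D) : Prop :=
  ∀ v : ℕ → L2 D, dcost 𝒯 α β τ N l z u ≤ dcost 𝒯 α β τ N l z v

/-- The value function of the discrete LQ problem. -/
def dvalue {d : ℕ} {D : Set (Euc d)} {h : ℝ} (𝒯 : Triangulation D h) (α β τ : ℝ) (N l : ℕ)
    (z : L2 D) : ℝ :=
  ⨅ u : ℕ → L2 D, dcost 𝒯 α β τ N l z u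

end

/-! Everything diagonalizes at once. `𝒜_h` is symmetric on the finite-dimensional space `𝕍_h`, and
since `𝕍_h ⊆ H¹₀(D)`, assumption (H) bounds the eigenvalues `λ` of `-𝒜_h` below by `C₀`, uniformly
in the mesh (`exists_shiftedLaplacian_eq_neg_diag`). All coefficients and the terminal datum `α 1`
are functions of `𝒜_h`, so in an eigenbasis both Riccati equations split into scalar ones:
`riccati_eq_diag` (by ODE uniqueness) and `differenceRiccati_eq_diag` (by backward induction). The
operator error is then controlled by the largest scalar error, and no approximation property of
finite elements enters.

The scalar estimate `exists_abs_scalarRiccati_sub_iterate_le` bounds the error after `k ≥ 1` steps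
by `C (α / k + τ)`, uniformly in `λ ≥ C₀`. Put `b = (1 + τ λ)⁻²`, the damping factor of one step. If
`τ λ ≥ 1`, flow and scheme are both at most `α b^k + 2 τ`, and `b^k ≤ 1 / k`. If `τ λ ≤ 1`, a local
error of order `τ² (λ + λ² p)`, where `p ≤ α b^j + 1 / (2 λ)`, is propagated by a step contracting
with factor `b`. The part of order `τ² λ` sums to `O(τ)` because `1 - b` is comparable to `τ λ`; the
rest sums to a multiple of `α (τ λ)² k b^k ≤ α / k`. With `k = N - l` and `k τ = T - t_l` this is
the claim; the logarithm serves only as a quantity bounded away from zero for `τ ≤ τ₀ < 1`.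

The control problem is solved by completing the square (`inner_step_completing_square`): the cost is
the Riccati value plus nonnegative excess terms that vanish exactly under the feedback law. -/

/-! ### The scalar Riccati flow in closed form -/

/-- `tanh (r s) / r`. -/
noncomputable def tanhDiv (r s : ℝ) : ℝ := Real.sinh (r * s) / (r * Real.cosh (r * s))

theorem tanhDiv_zero (r : ℝ) : tanhDiv r 0 = 0 := by simp [tanhDiv]

theorem tanhDiv_nonneg {r s : ℝ} (hr : 0 < r) (hs : 0 ≤ s) : 0 ≤ tanhDiv r s := by
  have := Real.cosh_pos (r * s)
  have : 0 ≤ Real.sinh (r * s) := Real.sinh_nonneg_iff.2 (by positivity)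
  unfold tanhDiv; positivity

theorem mul_tanhDiv_le_one {r : ℝ} (s : ℝ) (hr : 0 < r) : r * tanhDiv r s ≤ 1 := by
  have hc := Real.cosh_pos (r * s)
  have h := Real.sinh_lt_cosh (r * s)
  rw [tanhDiv, ← mul_div_assoc, mul_div_mul_left _ _ hr.ne', div_le_one hc]
  exact h.le

theorem tanhDiv_add {r : ℝ} (hr : 0 < r) (s t : ℝ) (hs : 0 ≤ s) (ht : 0 ≤ t) :
    tanhDiv r (s + t) = (tanhDiv r s + tanhDiv r t) / (1 + r ^ 2 * tanhDiv r s * tanhDiv r t) := by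
  have hc := Real.cosh_pos (r * s)
  have hc' := Real.cosh_pos (r * t)
  have h1 : 0 ≤ Real.sinh (r * s) := Real.sinh_nonneg_iff.2 (by positivity)
  have h2 : 0 ≤ Real.sinh (r * t) := Real.sinh_nonneg_iff.2 (by positivity)
  unfold tanhDiv
  rw [mul_add, Real.sinh_add, Real.cosh_add]
  have : 0 < Real.cosh (r * s) * Real.cosh (r * t) + Real.sinh (r * s) * Real.sinh (r * t) := by
    positivity
  field_simp

theorem hasDerivAt_tanhDiv {r : ℝ} (hr : 0 < r) (s : ℝ) :
    HasDerivAt (tanhDiv r) (1 - r ^ 2 * tanhDiv r s ^ 2) s := by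
  have hc := Real.cosh_pos (r * s)
  have hl : HasDerivAt (fun s : ℝ => r * s) r s := by simpa using (hasDerivAt_id s).const_mul r
  have h := (hl.sinh).div ((hl.cosh).const_mul r) (by positivity)
  refine h.congr_deriv ?_
  unfold tanhDiv
  field_simp

theorem tanhDiv_le {r s : ℝ} (hr : 0 < r) (hs : 0 ≤ s) : tanhDiv r s ≤ s := by
  have hmono : MonotoneOn (fun s => s - tanhDiv r s) (Set.Ici 0) := by
    apply monotoneOn_of_deriv_nonneg (convex_Ici 0)
    · exact fun x _ => ((hasDerivAt_id x).sub (hasDerivAt_tanhDiv hr x)).continuousAt.continuousWithinAt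
    · exact fun x _ => ((hasDerivAt_id x).sub
        (hasDerivAt_tanhDiv hr x)).differentiableAt.differentiableWithinAt
    · intro x _
      have := ((hasDerivAt_id x).sub (hasDerivAt_tanhDiv hr x)).deriv
      change 0 ≤ deriv (id - tanhDiv r) x
      rw [this]
      nlinarith [sq_nonneg (r * tanhDiv r x)]
  have := hmono (Set.self_mem_Ici) hs hs
  simpa [tanhDiv_zero] using this

/-- With `u = r s`, the inequality `1 + 2 u ≤ exp (2 u)` gives `tanh u ≥ u / (1 + u) ≥ u - u²`. -/
theorem sub_tanhDiv_le {r s : ℝ} (hr : 0 < r) (hs : 0 ≤ s) : s - tanhDiv r s ≤ r * s ^ 2 := by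
  set u := r * s with hu
  have hu0 : 0 ≤ u := by positivity
  have h1 : u + 1 ≤ Real.exp u := Real.add_one_le_exp u
  have h2 : Real.exp u * Real.exp (-u) = 1 := by rw [← Real.exp_add]; simp
  have hc := Real.cosh_pos u
  have h4 : u * Real.cosh u ≤ (1 + u) * Real.sinh u := by
    rw [Real.cosh_eq, Real.sinh_eq]
    have h3 := Real.exp_pos (-u)
    have : (1 + 2 * u) * Real.exp (-u) ≤ Real.exp u := by
      have := Real.add_one_le_exp (2 * u)
      have h5 : Real.exp (2 * u) * Real.exp (-u) = Real.exp u := by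
        rw [← Real.exp_add]; ring_nf
      nlinarith
    linarith
  have h6 : u - u ^ 2 ≤ r * tanhDiv r s := by
    have e : r * tanhDiv r s = Real.sinh u / Real.cosh u := by
      unfold tanhDiv; rw [← hu]; field_simp
    rw [e, le_div_iff₀ hc]
    have h7 : (u - u ^ 2) * (1 + u) ≤ u := by nlinarith [pow_nonneg hu0 3]
    have h8 : (1 + u) * ((u - u ^ 2) * Real.cosh u) ≤ (1 + u) * Real.sinh u := by nlinarith
    exact le_of_mul_le_mul_left h8 (by linarith)
  rw [hu] at h6
  have : r * (s - tanhDiv r s) ≤ r * (r * s ^ 2) := by nlinarith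
  exact le_of_mul_le_mul_left this hr

/-- The solution of `q' = 1 - 2 l q - q²`, `q 0 = a`. -/
noncomputable def scalarRiccati (l a s : ℝ) : ℝ :=
  (a + tanhDiv √(l ^ 2 + 1) s * (1 - l * a)) / (1 + tanhDiv √(l ^ 2 + 1) s * (a + l))

theorem scalarRiccati_zero (l a : ℝ) : scalarRiccati l a 0 = a := by
  simp [scalarRiccati, tanhDiv_zero]

section
variable {l a : ℝ} (hl : 0 ≤ l) (ha : 0 ≤ a)
include hl ha

theorem scalarRiccati_nonneg {s : ℝ} (hs : 0 ≤ s) : 0 ≤ scalarRiccati l a s := by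
  have hr : 0 < √(l ^ 2 + 1) := by positivity
  have h1 := tanhDiv_nonneg hr hs
  have h2 := mul_tanhDiv_le_one s hr
  have h3 : l ≤ √(l ^ 2 + 1) := Real.le_sqrt_of_sq_le (by linarith)
  unfold scalarRiccati
  set θ := tanhDiv √(l ^ 2 + 1) s
  have : l * θ ≤ 1 := (mul_le_mul_of_nonneg_right h3 h1).trans h2
  apply div_nonneg
  · nlinarith
  · positivity

theorem hasDerivAt_scalarRiccati {s : ℝ} (hs : 0 ≤ s) :
    HasDerivAt (scalarRiccati l a)
      (1 - 2 * l * scalarRiccati l a s - scalarRiccati l a s ^ 2) s := by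
  have hr : 0 < √(l ^ 2 + 1) := by positivity
  have hr2 : √(l ^ 2 + 1) ^ 2 = l ^ 2 + 1 := Real.sq_sqrt (by positivity)
  have h1 := tanhDiv_nonneg hr hs
  have hd := hasDerivAt_tanhDiv hr s
  have hden : 0 < 1 + tanhDiv √(l ^ 2 + 1) s * (a + l) := by positivity
  have h := ((hd.mul_const (1 - l * a)).const_add a).div ((hd.mul_const (a + l)).const_add 1)
    hden.ne'
  refine h.congr_deriv ?_
  rw [hr2]
  unfold scalarRiccati
  set θ := tanhDiv √(l ^ 2 + 1) s
  field_simp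
  ring

/-- The semigroup property comes from the addition theorem of `tanh`. It allows the flow to be
compared with the scheme one step at a time. -/
theorem scalarRiccati_add {s t : ℝ} (hs : 0 ≤ s) (ht : 0 ≤ t) :
    scalarRiccati l a (s + t) = scalarRiccati l (scalarRiccati l a s) t := by
  have hr : 0 < √(l ^ 2 + 1) := by positivity
  have hr2 : √(l ^ 2 + 1) ^ 2 = l ^ 2 + 1 := Real.sq_sqrt (by positivity)
  have h1 := tanhDiv_nonneg hr hs
  have h2 := tanhDiv_nonneg hr ht
  have h3 := scalarRiccati_nonneg hl ha hs
  unfold scalarRiccati at h3 ⊢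
  rw [tanhDiv_add hr s t hs ht, hr2]
  set θ := tanhDiv √(l ^ 2 + 1) s
  set η := tanhDiv √(l ^ 2 + 1) t
  have hden : 0 < 1 + θ * (a + l) := by positivity
  have hden1 : 0 < 1 + (l ^ 2 + 1) * θ * η := by positivity
  have hden2 : 0 < 1 + (θ + η) / (1 + (l ^ 2 + 1) * θ * η) * (a + l) := by positivity
  have hden3 : 0 < 1 + η * ((a + θ * (1 - l * a)) / (1 + θ * (a + l)) + l) := by positivity
  rw [div_eq_div_iff hden2.ne' hden3.ne']
  field_simp
  ring

end

/-- Dropping `-q²` leaves a linear equation with equilibrium `1 / (2 l)`; the integrating factor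
`exp (2 l s)` turns this into monotonicity. -/
theorem scalarRiccati_le {l a s : ℝ} (hl : 0 < l) (ha : 0 ≤ a) (hs : 0 ≤ s) :
    scalarRiccati l a s ≤ a * Real.exp (-(2 * l * s)) + 1 / (2 * l) := by
  have hd : ∀ s, 0 ≤ s → HasDerivAt
      (fun s => Real.exp (2 * l * s) * (scalarRiccati l a s - 1 / (2 * l)))
      (-(Real.exp (2 * l * s) * scalarRiccati l a s ^ 2)) s := by
    intro s hs
    have h0 : HasDerivAt (fun s : ℝ => 2 * l * s) (2 * l) s := by
      simpa using (hasDerivAt_id s).const_mul (2 * l)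
    have h := h0.exp.mul ((hasDerivAt_scalarRiccati hl.le ha hs).sub_const (1 / (2 * l)))
    refine h.congr_deriv ?_
    field_simp
    ring
  have hanti : AntitoneOn
      (fun s => Real.exp (2 * l * s) * (scalarRiccati l a s - 1 / (2 * l))) (Set.Ici 0) := by
    apply antitoneOn_of_deriv_nonpos (convex_Ici 0)
    · exact fun x hx => (hd x hx).continuousAt.continuousWithinAt
    · intro x hx
      rw [interior_Ici] at hx
      exact (hd x hx.le).differentiableAt.differentiableWithinAt
    · intro x hx
      rw [interior_Ici] at hx
      rw [(hd x hx.le).deriv]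
      have : 0 ≤ Real.exp (2 * l * x) * scalarRiccati l a x ^ 2 := by positivity
      linarith
  have h := hanti (Set.self_mem_Ici) hs hs
  simp only [mul_zero, Real.exp_zero, one_mul, scalarRiccati_zero] at h
  have he : Real.exp (-(2 * l * s)) * Real.exp (2 * l * s) = 1 := by rw [← Real.exp_add]; simp
  have hp := Real.exp_pos (-(2 * l * s))
  have h5 := mul_le_mul_of_nonneg_left h hp.le
  rw [← mul_assoc, he, one_mul] at h5
  have : 0 ≤ Real.exp (-(2 * l * s)) * (1 / (2 * l)) := by positivity
  linarith

/-! ### The scalar difference scheme -/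

/-- One backward step of the scalar difference Riccati equation. -/
noncomputable def riccatiStep (τ l p : ℝ) : ℝ :=
  τ + ((1 + τ * l) ^ 2)⁻¹ * p / (1 + τ * (((1 + τ * l) ^ 2)⁻¹ * p))

section
variable {τ l : ℝ} (hτ : 0 < τ) (hl : 0 < l)
include hτ hl

theorem riccatiStep_pos {p : ℝ} (hp : 0 ≤ p) : 0 < riccatiStep τ l p := by
  unfold riccatiStep; positivity

theorem riccatiStep_le {p : ℝ} (hp : 0 ≤ p) :
    riccatiStep τ l p ≤ τ + ((1 + τ * l) ^ 2)⁻¹ * p := by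
  unfold riccatiStep
  gcongr
  apply div_le_self (by positivity)
  have : 0 ≤ τ * (((1 + τ * l) ^ 2)⁻¹ * p) := by positivity
  linarith

/-- The map `y ↦ y / (1 + τ y)` is nonexpansive on `y ≥ 0`, so a step contracts with the factor of
the linear part. -/
theorem abs_riccatiStep_sub_le {p q : ℝ} (hp : 0 ≤ p) (hq : 0 ≤ q) :
    |riccatiStep τ l p - riccatiStep τ l q| ≤ ((1 + τ * l) ^ 2)⁻¹ * |p - q| := by
  unfold riccatiStep
  set b := ((1 + τ * l) ^ 2)⁻¹ with hb
  have hb0 : 0 < b := by positivity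
  have h1 : 0 ≤ τ * (b * p) := by positivity
  have h2 : 0 ≤ τ * (b * q) := by positivity
  have e : τ + b * p / (1 + τ * (b * p)) - (τ + b * q / (1 + τ * (b * q)))
      = b * (p - q) / ((1 + τ * (b * p)) * (1 + τ * (b * q))) := by
    have : 1 + τ * (b * p) ≠ 0 := by positivity
    have : 1 + τ * (b * q) ≠ 0 := by positivity
    field_simp
    ring
  rw [e, abs_div, abs_mul, abs_of_pos hb0]
  apply div_le_self (by positivity)
  rw [abs_of_pos (by positivity)]
  nlinarith

end

/-! ### Local and global error, uniformly in the eigenvalue -/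

theorem abs_sum_eight_le {x1 x2 x3 x4 x5 x6 x7 x8 : ℝ} {y1 y2 y3 y4 y5 y6 y7 y8 : ℝ}
    (h1 : |x1| ≤ y1) (h2 : |x2| ≤ y2) (h3 : |x3| ≤ y3) (h4 : |x4| ≤ y4) (h5 : |x5| ≤ y5)
    (h6 : |x6| ≤ y6) (h7 : |x7| ≤ y7) (h8 : |x8| ≤ y8) :
    |x1 + x2 + x3 + x4 + x5 + x6 + x7 + x8| ≤ y1 + y2 + y3 + y4 + y5 + y6 + y7 + y8 := by
  rw [abs_le] at *
  constructor <;> linarith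

set_option maxHeartbeats 400000 in
/-- The local truncation error. -/
theorem abs_scalarRiccati_sub_riccatiStep_le {c M τ l p : ℝ} (hc : 0 < c) (hτ : 0 < τ)
    (hτ1 : τ ≤ 1) (hl : c ≤ l) (hx : τ * l ≤ 1) (hp : 0 ≤ p) (hpM : p ≤ M) :
    |scalarRiccati l p τ - riccatiStep τ l p| ≤
      ((1 + c⁻¹) * (10 + 6 * M + 3 * M ^ 2) + 3) * (τ ^ 2 * (l + l ^ 2 * p)) := by
  have hl0 : 0 < l := hc.trans_le hl
  have hr : 0 < √(l ^ 2 + 1) := by positivity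
  have hr1 : √(l ^ 2 + 1) ≤ 1 + l := Real.sqrt_le_iff.2 ⟨by positivity, by nlinarith⟩
  have h1 := tanhDiv_nonneg hr hτ.le
  have h2 := tanhDiv_le hr hτ.le
  have h3 := sub_tanhDiv_le hr hτ.le
  -- Since `l ≥ c`, constants are absorbed into multiples of `l`: `1 + l ≤ κ l`.
  obtain ⟨κ, hκ⟩ : ∃ κ, κ = 1 + c⁻¹ := ⟨_, rfl⟩
  rw [← hκ]
  have hκ1 : 1 ≤ κ := by rw [hκ]; have := inv_pos.2 hc; linarith
  have hκl : 1 + l ≤ κ * l := by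
    have : 1 ≤ c⁻¹ * l := by rw [inv_mul_eq_div, one_le_div hc]; exact hl
    rw [hκ]; linarith
  unfold scalarRiccati riccatiStep
  generalize tanhDiv √(l ^ 2 + 1) τ = θ at h1 h2 h3 ⊢
  have hδ : τ - θ ≤ τ ^ 2 * (κ * l) := by nlinarith [sq_nonneg τ]
  have hM : 0 ≤ M := hp.trans hpM
  -- The first-order terms of the numerator cancel up to multiples of `τ - θ = O(τ² l)`. The groups
  -- that remain are bounded one by one below, and the denominator is at least `1`.
  have e : (p + θ * (1 - l * p)) / (1 + θ * (p + l)) -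
      (τ + ((1 + τ * l) ^ 2)⁻¹ * p / (1 + τ * (((1 + τ * l) ^ 2)⁻¹ * p))) =
      (-((τ - θ) * (1 + τ * l) ^ 2) + (τ - θ) * p ^ 2 + 2 * l * p * (τ - θ)
        + (p * (τ * l) ^ 2 - θ * l * p * (2 * (τ * l) + (τ * l) ^ 2))
        + -(τ * p * (τ - θ)) + -(θ * l * τ * p ^ 2) + -(θ * (p + l) * τ * (1 + τ * l) ^ 2)
        + -(θ * (p + l) * τ ^ 2 * p)) /
      ((1 + θ * (p + l)) * ((1 + τ * l) ^ 2 + τ * p)) := by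
    have d1 : 1 + θ * (p + l) ≠ 0 := by positivity
    have d2 : (1 + τ * l) ^ 2 + τ * p ≠ 0 := by positivity
    have d3 : 1 + τ * l ≠ 0 := by positivity
    have e2 : ((1 + τ * l) ^ 2)⁻¹ * p / (1 + τ * (((1 + τ * l) ^ 2)⁻¹ * p))
        = p / ((1 + τ * l) ^ 2 + τ * p) := by
      have d4 : 1 + τ * (((1 + τ * l) ^ 2)⁻¹ * p) ≠ 0 := by positivity
      rw [div_eq_div_iff d4 d2]
      field_simp
    rw [e2]
    field_simp
    ring
  rw [e, abs_div]
  have hX1 : 1 ≤ (1 + τ * l) ^ 2 := by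
    have : 0 < τ * l := by positivity
    nlinarith
  have hX4 : (1 + τ * l) ^ 2 ≤ 4 := by
    have : 0 < τ * l := by positivity
    nlinarith
  have hden : 1 ≤ |(1 + θ * (p + l)) * ((1 + τ * l) ^ 2 + τ * p)| := by
    rw [abs_of_pos (by positivity)]
    have : 0 ≤ θ * (p + l) := by positivity
    have : 0 ≤ τ * p := by positivity
    exact one_le_mul_of_one_le_of_one_le (by linarith) (by linarith)
  refine (div_le_self (abs_nonneg _) hden).trans ?_
  have hδ0 : 0 ≤ τ - θ := by linarith
  have hx0 : 0 < τ * l := by positivity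
  have g1 : |-((τ - θ) * (1 + τ * l) ^ 2)| ≤ τ ^ 2 * (κ * l) * 4 := by
    rw [abs_neg, abs_of_nonneg (by positivity)]; gcongr
  have g2 : |(τ - θ) * p ^ 2| ≤ τ ^ 2 * (κ * l) * M ^ 2 := by
    rw [abs_of_nonneg (by positivity)]; gcongr
  have g3 : |2 * l * p * (τ - θ)| ≤ 2 * l * p * (τ ^ 2 * (κ * l)) := by
    rw [abs_of_nonneg (by positivity)]; gcongr
  have g4 : |p * (τ * l) ^ 2 - θ * l * p * (2 * (τ * l) + (τ * l) ^ 2)| ≤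
      3 * (τ ^ 2 * (l ^ 2 * p)) := by
    have a1 : 0 ≤ θ * l * p * (2 * (τ * l) + (τ * l) ^ 2) := by positivity
    have a2 : θ * l * p * (2 * (τ * l) + (τ * l) ^ 2) ≤ τ * l * p * (2 * (τ * l) + τ * l) := by
      gcongr
      exact pow_le_of_le_one hx0.le hx two_ne_zero
    have a3 : 0 ≤ τ ^ 2 * (l ^ 2 * p) := by positivity
    rw [abs_le]
    constructor <;> linarith
  have g5 : |-(τ * p * (τ - θ))| ≤ τ ^ 2 * (κ * l) * M := by
    rw [abs_neg, abs_of_nonneg (by positivity)]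
    calc τ * p * (τ - θ) ≤ 1 * M * (τ ^ 2 * (κ * l)) := by gcongr
      _ = _ := by ring
  have g6 : |-(θ * l * τ * p ^ 2)| ≤ τ ^ 2 * (κ * l) * M ^ 2 := by
    rw [abs_neg, abs_of_nonneg (by positivity)]
    calc θ * l * τ * p ^ 2 ≤ τ * (κ * l) * τ * M ^ 2 := by
          gcongr
          linarith
      _ = _ := by ring
  have hpl : p + l ≤ (1 + M) * (κ * l) := by
    have := mul_le_mul_of_nonneg_left (show 1 ≤ κ * l by linarith) hM
    linarith
  have g7 : |-(θ * (p + l) * τ * (1 + τ * l) ^ 2)| ≤ τ ^ 2 * (κ * l) * (4 * (1 + M)) := by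
    rw [abs_neg, abs_of_nonneg (by positivity)]
    calc θ * (p + l) * τ * (1 + τ * l) ^ 2 ≤ τ * ((1 + M) * (κ * l)) * τ * 4 := by gcongr
      _ = _ := by ring
  have g8 : |-(θ * (p + l) * τ ^ 2 * p)| ≤ τ ^ 2 * (κ * l) * ((1 + M) * M) := by
    rw [abs_neg, abs_of_nonneg (by positivity)]
    calc θ * (p + l) * τ ^ 2 * p ≤ 1 * ((1 + M) * (κ * l)) * τ ^ 2 * M := by
          gcongr
          linarith
      _ = _ := by ring
  refine (abs_sum_eight_le g1 g2 g3 g4 g5 g6 g7 g8).trans ?_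
  have f3 : 0 ≤ τ ^ 2 * l := by positivity
  have f4 : 0 ≤ κ * (τ ^ 2 * (l ^ 2 * p)) * (8 + 6 * M + 3 * M ^ 2) := by positivity
  have f5 : 0 ≤ κ * (τ ^ 2 * l) := by positivity
  linear_combination 3 * f3 + f4 + 2 * f5

theorem riccatiStep_iterate_nonneg {τ l a : ℝ} (hτ : 0 < τ) (hl : 0 < l) (ha : 0 ≤ a) (k : ℕ) :
    0 ≤ (riccatiStep τ l)^[k] a := by
  induction k with
  | zero => exact ha
  | succ k ih =>
    rw [Function.iterate_succ_apply']
    exact (riccatiStep_pos hτ hl ih).le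

/-- Bernoulli: `(1 + x)^k ≥ 1 + k x ≥ k`. -/
theorem inv_pow_sq_le_inv {x : ℝ} (hx : 1 ≤ x) {k : ℕ} (hk : 0 < k) :
    (((1 + x) ^ 2)⁻¹) ^ k ≤ (k : ℝ)⁻¹ := by
  have hk' : (0 : ℝ) < k := by exact_mod_cast hk
  rw [inv_pow]
  apply inv_anti₀ hk'
  have h := one_add_mul_le_pow (show (-2 : ℝ) ≤ x by linarith) k
  have h1 : (1 + x) ^ k ≤ ((1 + x) ^ 2) ^ k := by
    apply pow_le_pow_left₀ (by linarith)
    nlinarith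
  nlinarith

/-- The smoothing estimate behind the singular weight `1 / (T - t)`: Bernoulli gives `(k x)² ≤ (1 +
x)^(2 k)`. -/
theorem sq_mul_mul_inv_pow_le {x : ℝ} (hx : 0 ≤ x) {k : ℕ} (hk : 0 < k) :
    x ^ 2 * k * (((1 + x) ^ 2)⁻¹) ^ k ≤ (k : ℝ)⁻¹ := by
  have hk' : (0 : ℝ) < k := by exact_mod_cast hk
  have h := one_add_mul_le_pow (show (-2 : ℝ) ≤ x by linarith) k
  have h1 : (k * x) ^ 2 ≤ ((1 + x) ^ 2) ^ k := by
    rw [← pow_mul, mul_comm 2 k, pow_mul]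
    apply pow_le_pow_left₀ (by positivity)
    linarith
  rw [inv_pow, ← div_eq_mul_inv, div_le_iff₀ (by positivity)]
  calc x ^ 2 * k = (k : ℝ)⁻¹ * (k * x) ^ 2 := by field_simp
    _ ≤ _ := by gcongr

/-- Since `1 + x ≤ exp x`, the exact flow is damped at least as strongly as the scheme, so powers of
the same factor bound both. -/
theorem exp_neg_two_mul_le {x : ℝ} (hx : 0 ≤ x) (k : ℕ) :
    Real.exp (-(2 * x * k)) ≤ (((1 + x) ^ 2)⁻¹) ^ k := by
  have h : Real.exp (-(2 * x)) ≤ ((1 + x) ^ 2)⁻¹ := by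
    rw [Real.exp_neg]
    apply inv_anti₀ (by positivity)
    have := Real.add_one_le_exp x
    calc (1 + x) ^ 2 ≤ Real.exp x ^ 2 := by gcongr; linarith
      _ = _ := by rw [← Real.exp_nat_mul]; norm_num
  calc Real.exp (-(2 * x * k)) = Real.exp (-(2 * x)) ^ k := by
        rw [← Real.exp_nat_mul]; ring_nf
    _ ≤ _ := by gcongr

theorem scalarRiccati_le_pow {τ l a : ℝ} (hτ : 0 < τ) (hl : 0 < l) (ha : 0 ≤ a) (k : ℕ) :
    scalarRiccati l a (k * τ) ≤ a * (((1 + τ * l) ^ 2)⁻¹) ^ k + 1 / (2 * l) := by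
  refine (scalarRiccati_le hl ha (by positivity)).trans ?_
  have h := exp_neg_two_mul_le (x := τ * l) (by positivity) k
  have e : 2 * l * (k * τ) = 2 * (τ * l) * k := by ring
  rw [e]
  gcongr

/-- The global error for stiffness parameter `τ l ≥ 1`. -/
theorem abs_scalarRiccati_sub_iterate_le_of_one_le {τ l a : ℝ} (hτ : 0 < τ) (hl : 0 < l)
    (hx : 1 ≤ τ * l) (ha : 0 ≤ a) {k : ℕ} (hk : 0 < k) :
    |scalarRiccati l a (k * τ) - (riccatiStep τ l)^[k] a| ≤ a * (k : ℝ)⁻¹ + 2 * τ := by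
  have hpow := inv_pow_sq_le_inv hx hk
  have hb4 : ((1 + τ * l) ^ 2)⁻¹ ≤ 1 / 4 := by
    rw [inv_le_comm₀ (by positivity) (by norm_num)]
    nlinarith
  have hb0 : 0 < ((1 + τ * l) ^ 2)⁻¹ := by positivity
  have hq : scalarRiccati l a (k * τ) ≤ a * (k : ℝ)⁻¹ + 2 * τ := by
    have h1 : 1 / (2 * l) ≤ τ := by
      rw [div_le_iff₀ (by positivity)]; linarith
    have := scalarRiccati_le_pow hτ hl ha k
    have := mul_le_mul_of_nonneg_left hpow ha
    linarith
  -- The level `2 τ` is preserved, as `τ + b * (2 * τ) ≤ 2 * τ` for `b ≤ 1 / 4`.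
  have hs : ∀ j : ℕ, (riccatiStep τ l)^[j] a ≤ a * (((1 + τ * l) ^ 2)⁻¹) ^ j + 2 * τ := by
    intro j
    induction j with
    | zero => simp; positivity
    | succ j ih =>
      rw [Function.iterate_succ_apply']
      refine (riccatiStep_le hτ hl (riccatiStep_iterate_nonneg hτ hl ha j)).trans ?_
      have := mul_le_mul_of_nonneg_left ih hb0.le
      rw [pow_succ _ j]
      nlinarith
  have hsk := hs k
  have := mul_le_mul_of_nonneg_left hpow ha
  have := riccatiStep_iterate_nonneg hτ hl ha k
  have := scalarRiccati_nonneg hl.le ha (s := k * τ) (by positivity)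
  rw [abs_le]
  constructor <;> linarith

/-- The global error for stiffness parameter `τ l ≤ 1`. -/
theorem abs_scalarRiccati_sub_iterate_le_of_le_one {c τ l a B : ℝ} (hc : 0 < c) (hτ : 0 < τ)
    (hτ1 : τ ≤ 1) (hl : c ≤ l) (hx : τ * l ≤ 1) (ha : 0 ≤ a)
    (hB : B = (1 + c⁻¹) * (10 + 6 * (a + c⁻¹) + 3 * (a + c⁻¹) ^ 2) + 3) {k : ℕ} (hk : 0 < k) :
    |scalarRiccati l a (k * τ) - (riccatiStep τ l)^[k] a| ≤ 4 * B * (a * (k : ℝ)⁻¹ + τ) := by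
  have hl0 : 0 < l := hc.trans_le hl
  have hx0 : 0 < τ * l := by positivity
  have hB0 : 0 < B := by rw [hB]; positivity
  obtain ⟨b, hb⟩ : ∃ b, b = ((1 + τ * l) ^ 2)⁻¹ := ⟨_, rfl⟩
  have hb0 : 0 < b := by rw [hb]; positivity
  have hbX : b * (1 + τ * l) ^ 2 = 1 := by rw [hb]; field_simp
  have hb1 : b ≤ 1 := by rw [hb]; exact inv_le_one_of_one_le₀ (by nlinarith)
  -- This allows the source term with `b ^ j` to be charged to `b ^ (j + 1)`.
  have hb4 : 1 ≤ 4 * b := by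
    have hX4 : (1 + τ * l) ^ 2 ≤ 4 := by nlinarith
    have := mul_le_mul_of_nonneg_left hX4 hb0.le
    linarith
  -- Summing a source proportional to `τ l` against the contraction factor `b` costs at most `1 / (1
  -- - b)`, which this bound compensates.
  have hbx : τ * l ≤ 2 * (1 - b) := by
    have h1 := mul_le_mul_of_nonneg_right hb4 hx0.le
    have h2 : 0 ≤ b * (τ * l) ^ 2 := by positivity
    linarith
  -- The level `4 B τ` is a fixed point of `e ↦ b e + 4 B τ (1 - b)`; in the second term each step
  -- raises the factor `j` by one.
  have main : ∀ j : ℕ, |scalarRiccati l a (j * τ) - (riccatiStep τ l)^[j] a| ≤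
      4 * B * τ + 4 * B * a * ((τ * l) ^ 2 * j * b ^ j) := by
    intro j
    induction j with
    | zero => simp [scalarRiccati_zero]; positivity
    | succ j ih =>
      have hp0 := scalarRiccati_nonneg hl0.le ha (s := j * τ) (by positivity)
      have hple := scalarRiccati_le_pow hτ hl0 ha j
      rw [← hb] at hple
      have hstep : scalarRiccati l a ((j + 1 : ℕ) * τ) =
          scalarRiccati l (scalarRiccati l a (j * τ)) τ := by
        rw [← scalarRiccati_add hl0.le ha (by positivity) hτ.le]
        push_cast; ring_nf
      rw [hstep, Function.iterate_succ_apply']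
      generalize scalarRiccati l a (j * τ) = p at *
      have hs0 := riccatiStep_iterate_nonneg hτ hl0 ha j
      generalize (riccatiStep τ l)^[j] a = s at *
      have hbj : b ^ j ≤ 1 := pow_le_one₀ hb0.le hb1
      have hbj0 : 0 < b ^ j := by positivity
      have hpM : p ≤ a + c⁻¹ := by
        have h1 : 1 / (2 * l) ≤ c⁻¹ := by
          rw [one_div]; exact inv_anti₀ hc (by linarith)
        have h2 := mul_le_mul_of_nonneg_left hbj ha
        linarith
      have hloc := abs_scalarRiccati_sub_riccatiStep_le hc hτ hτ1 hl hx hp0 hpM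
      rw [← hB] at hloc
      have hcon := abs_riccatiStep_sub_le hτ hl0 hp0 hs0
      rw [← hb] at hcon
      have htri := abs_sub_le (scalarRiccati l p τ) (riccatiStep τ l p) (riccatiStep τ l s)
      have hlp : l ^ 2 * p ≤ l ^ 2 * a * b ^ j + l := by
        calc l ^ 2 * p ≤ l ^ 2 * (a * b ^ j + 1 / (2 * l)) := by gcongr
          _ = l ^ 2 * a * b ^ j + l / 2 := by field_simp
          _ ≤ _ := by linarith
      have h1 : B * (τ ^ 2 * (l + l ^ 2 * p)) ≤
          B * τ * (2 * (τ * l)) + B * a * (τ * l) ^ 2 * b ^ j := by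
        calc B * (τ ^ 2 * (l + l ^ 2 * p)) ≤ B * (τ ^ 2 * (l + (l ^ 2 * a * b ^ j + l))) := by
              gcongr
          _ = _ := by ring
      have h2 := mul_le_mul_of_nonneg_left ih hb0.le
      have h3 : B * τ * (2 * (τ * l)) ≤ B * τ * (4 * (1 - b)) := by
        apply mul_le_mul_of_nonneg_left _ (by positivity); linarith
      have h4 : B * a * (τ * l) ^ 2 * b ^ j * 1 ≤ B * a * (τ * l) ^ 2 * b ^ j * (4 * b) := by
        apply mul_le_mul_of_nonneg_left hb4 (by positivity)
      rw [pow_succ _ j]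
      push_cast
      linarith
  have hfin := sq_mul_mul_inv_pow_le hx0.le hk
  rw [← hb] at hfin
  have := mul_le_mul_of_nonneg_left hfin (show 0 ≤ 4 * B * a by positivity)
  linarith [main k]

/-- Uniform error estimate for the scalar Riccati equations. -/
theorem exists_abs_scalarRiccati_sub_iterate_le {c a : ℝ} (hc : 0 < c) (ha : 0 ≤ a) :
    ∃ C : ℝ, 0 < C ∧ ∀ τ l : ℝ, 0 < τ → τ ≤ 1 → c ≤ l → ∀ k : ℕ, 0 < k →
      |scalarRiccati l a (k * τ) - (riccatiStep τ l)^[k] a| ≤ C * (a * (k : ℝ)⁻¹ + τ) := by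
  obtain ⟨B, hB⟩ : ∃ B, B = (1 + c⁻¹) * (10 + 6 * (a + c⁻¹) + 3 * (a + c⁻¹) ^ 2) + 3 := ⟨_, rfl⟩
  -- Makes `4 B` exceed the constant `2` of the regime `τ l ≥ 1`.
  have hB0 : 3 ≤ B := by
    rw [hB]
    have : 0 ≤ (1 + c⁻¹) * (10 + 6 * (a + c⁻¹) + 3 * (a + c⁻¹) ^ 2) := by positivity
    linarith
  refine ⟨4 * B, by positivity, fun τ l hτ hτ1 hl k hk => ?_⟩
  rcases le_total (τ * l) 1 with hx | hx
  · exact abs_scalarRiccati_sub_iterate_le_of_le_one hc hτ hτ1 hl hx ha hB hk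
  · refine (abs_scalarRiccati_sub_iterate_le_of_one_le hτ (hc.trans_le hl) hx ha hk).trans ?_
    have : 0 ≤ a * (k : ℝ)⁻¹ := by positivity
    nlinarith

/-! ### Uniqueness for the operator Riccati equation -/

/-- Two given solutions are continuous, hence bounded on the compact interval, and the quadratic
right-hand side is Lipschitz on a ball containing both. -/
theorem riccati_ode_unique {R : Type*} [NormedRing R] [NormedAlgebra ℝ R] (A : R) {T : ℝ}
    {P Q : ℝ → R}
    (hP : ∀ t ∈ Set.Icc 0 T, HasDerivWithinAt P (-(A * P t + P t * A + 1 - P t ^ 2))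
      (Set.Icc 0 T) t)
    (hQ : ∀ t ∈ Set.Icc 0 T, HasDerivWithinAt Q (-(A * Q t + Q t * A + 1 - Q t ^ 2))
      (Set.Icc 0 T) t)
    (h : P T = Q T) : Set.EqOn P Q (Set.Icc 0 T) := by
  have cP : ContinuousOn P (Set.Icc 0 T) := fun t ht => (hP t ht).continuousWithinAt
  have cQ : ContinuousOn Q (Set.Icc 0 T) := fun t ht => (hQ t ht).continuousWithinAt
  obtain ⟨r₁, h₁⟩ := isCompact_Icc.exists_bound_of_continuousOn cP
  obtain ⟨r₂, h₂⟩ := isCompact_Icc.exists_bound_of_continuousOn cQ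
  set r := max r₁ r₂
  -- Uniqueness runs backwards from `T`, so derivatives from the left are needed.
  have hnhds : ∀ t ∈ Set.Ioc 0 T, Set.Icc 0 T ∈ nhdsWithin t (Set.Iic t) := fun t ht =>
    Filter.mem_of_superset (Icc_mem_nhdsLE ht.1) (Set.Icc_subset_Icc_right ht.2)
  refine ODE_solution_unique_of_mem_Icc_left
    (v := fun _ X => -(A * X + X * A + 1 - X ^ 2)) (s := fun _ => Metric.closedBall 0 r)
    (K := (‖A‖ + ‖A‖ + (r + r)).toNNReal) ?_ cP ?_ ?_ cQ ?_ ?_ h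
  · intro t _
    apply LipschitzOnWith.of_dist_le_mul
    intro X hX Y hY
    rw [mem_closedBall_zero_iff] at hX hY
    have hr : 0 ≤ r := (norm_nonneg X).trans hX
    rw [Real.coe_toNNReal _ (by positivity), dist_eq_norm, dist_eq_norm]
    have e : -(A * X + X * A + 1 - X ^ 2) - -(A * Y + Y * A + 1 - Y ^ 2)
        = X * (X - Y) + (X - Y) * Y - (A * (X - Y) + (X - Y) * A) := by noncomm_ring
    rw [e]
    have n1 := norm_mul_le X (X - Y)
    have n2 := norm_mul_le (X - Y) Y
    have n3 := norm_mul_le A (X - Y)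
    have n4 := norm_mul_le (X - Y) A
    have n5 := norm_sub_le (X * (X - Y) + (X - Y) * Y) (A * (X - Y) + (X - Y) * A)
    have n6 := norm_add_le (X * (X - Y)) ((X - Y) * Y)
    have n7 := norm_add_le (A * (X - Y)) ((X - Y) * A)
    have n8 := mul_le_mul_of_nonneg_right hX (norm_nonneg (X - Y))
    have n9 := mul_le_mul_of_nonneg_left hY (norm_nonneg (X - Y))
    linarith
  · exact fun t ht => (hP t ⟨ht.1.le, ht.2⟩).mono_of_mem_nhdsWithin (hnhds t ht)
  · exact fun t ht => mem_closedBall_zero_iff.2 ((h₁ t ⟨ht.1.le, ht.2⟩).trans (le_max_left _ _))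
  · exact fun t ht => (hQ t ⟨ht.1.le, ht.2⟩).mono_of_mem_nhdsWithin (hnhds t ht)
  · exact fun t ht => mem_closedBall_zero_iff.2 ((h₂ t ⟨ht.1.le, ht.2⟩).trans (le_max_right _ _))

/-! ### Operators diagonal in an orthonormal basis -/

namespace OrthonormalBasis

variable {ι V : Type*} [Fintype ι] [NormedAddCommGroup V] [InnerProductSpace ℝ V]
  (b : OrthonormalBasis ι ℝ V)

/-- The operators that are diagonal in an orthonormal basis. -/
noncomputable def diag : (ι → ℝ) →ₗ[ℝ] (V →L[ℝ] V) where
  toFun f := ∑ i, f i • (innerSL ℝ (b i)).smulRight (b i)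
  map_add' f g := by simp [add_smul, Finset.sum_add_distrib]
  map_smul' c f := by simp [mul_smul, Finset.smul_sum]

theorem diag_apply (f : ι → ℝ) (x : V) : b.diag f x = ∑ i, (f i * ⟪b i, x⟫) • b i := by
  simp [diag, mul_smul]

theorem inner_diag (f : ι → ℝ) (i : ι) (x : V) : ⟪b i, b.diag f x⟫ = f i * ⟪b i, x⟫ := by
  classical
  rw [diag_apply, inner_sum, Finset.sum_eq_single i]
  · simp [real_inner_smul_right]
  · intro j _ hj
    rw [real_inner_smul_right, b.inner_eq_ite, if_neg (Ne.symm hj), mul_zero]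
  · simp

theorem ext_inner_left {x y : V} (h : ∀ i, ⟪b i, x⟫ = ⟪b i, y⟫) : x = y := by
  apply b.repr.injective
  ext i
  simpa [b.repr_apply_apply] using h i

theorem diag_mul (f g : ι → ℝ) : b.diag (f * g) = b.diag f * b.diag g := by
  ext x
  apply b.ext_inner_left
  intro i
  rw [mul_apply_eq_comp]
  simp only [inner_diag, Pi.mul_apply]
  ring

theorem diag_const (c : ℝ) : b.diag (fun _ => c) = c • 1 := by
  ext x
  apply b.ext_inner_left
  intro i
  rw [inner_diag]
  simp [real_inner_smul_right]

theorem diag_one : b.diag 1 = 1 :=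
  (b.diag_const 1).trans (one_smul _ _)

theorem isUnit_diag {f : ι → ℝ} (hf : ∀ i, f i ≠ 0) : IsUnit (b.diag f) := by
  have h : f * f⁻¹ = 1 := by ext i; simp [hf i]
  refine ⟨⟨b.diag f, b.diag f⁻¹, ?_, ?_⟩, rfl⟩
  · rw [← diag_mul, h, diag_one]
  · rw [← diag_mul, mul_comm, h, diag_one]

theorem inverse_diag {f : ι → ℝ} (hf : ∀ i, f i ≠ 0) :
    Ring.inverse (b.diag f) = b.diag f⁻¹ := by
  have h : f * f⁻¹ = 1 := by ext i; simp [hf i]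
  have h1 : b.diag f * b.diag f⁻¹ = 1 := by rw [← diag_mul, h, diag_one]
  calc Ring.inverse (b.diag f)
      = Ring.inverse (b.diag f) * (b.diag f * b.diag f⁻¹) := by rw [h1, mul_one]
    _ = b.diag f⁻¹ := Ring.inverse_mul_cancel_left _ _ (b.isUnit_diag hf)

theorem isPositive_diag {f : ι → ℝ} (hf : ∀ i, 0 ≤ f i) : (b.diag f).IsPositive := by
  refine ⟨fun x y => ?_, fun x => ?_⟩
  · simp only [ContinuousLinearMap.coe_coe, diag_apply, sum_inner, inner_sum, real_inner_smul_left,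
      real_inner_smul_right]
    refine Finset.sum_congr rfl fun i _ => ?_
    rw [real_inner_comm x (b i)]
    ring
  · simp only [ContinuousLinearMap.reApplyInnerSelf, diag_apply, sum_inner, real_inner_smul_left]
    apply Finset.sum_nonneg
    intro i _
    have := hf i
    rw [mul_assoc]
    exact mul_nonneg this (mul_self_nonneg _)

theorem norm_diag_le {f : ι → ℝ} {M : ℝ} (hM : 0 ≤ M) (hf : ∀ i, |f i| ≤ M) :
    ‖b.diag f‖ ≤ M := by
  refine ContinuousLinearMap.opNorm_le_bound _ hM fun x => ?_
  rw [← sq_le_sq₀ (norm_nonneg _) (by positivity), mul_pow, ← b.sum_sq_inner_right,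
    ← b.sum_sq_inner_right x, Finset.mul_sum]
  apply Finset.sum_le_sum
  intro i _
  rw [inner_diag, mul_pow]
  exact mul_le_mul_of_nonneg_right (sq_le_sq' (abs_le.1 (hf i)).1 (abs_le.1 (hf i)).2)
    (sq_nonneg _)

theorem hasDerivWithinAt_diag {f : ℝ → ι → ℝ} {f' : ι → ℝ} {s : Set ℝ} {t : ℝ}
    (h : ∀ i, HasDerivWithinAt (fun t => f t i) (f' i) s t) :
    HasDerivWithinAt (fun t => b.diag (f t)) (b.diag f') s t :=
  (LinearMap.toContinuousLinearMap b.diag).hasFDerivAt.comp_hasDerivWithinAt t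
    (hasDerivWithinAt_pi.2 h)

end OrthonormalBasis

theorem exists_orthonormalBasis_eq_diag {V : Type*} [NormedAddCommGroup V] [InnerProductSpace ℝ V]
    [FiniteDimensional ℝ V] {A : V →L[ℝ] V} (hA : (A : V →ₗ[ℝ] V).IsSymmetric) :
    ∃ (b : OrthonormalBasis (Fin (Module.finrank ℝ V)) ℝ V) (f : Fin (Module.finrank ℝ V) → ℝ),
      A = b.diag f := by
  refine ⟨hA.eigenvectorBasis rfl, hA.eigenvalues rfl, ?_⟩
  ext x
  apply (hA.eigenvectorBasis rfl).ext_inner_left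
  intro i
  rw [OrthonormalBasis.inner_diag, ← OrthonormalBasis.repr_apply_apply,
    ← OrthonormalBasis.repr_apply_apply]
  exact hA.eigenvectorBasis_apply_self_apply rfl x i

/-! ### Completing the square -/

/-- Completing the square in one step of the linear-quadratic problem. -/
theorem inner_step_completing_square {V : Type*} [NormedAddCommGroup V] [InnerProductSpace ℝ V]
    {A P K : V →L[ℝ] V} {τ : ℝ} (hA : ∀ x y, ⟪A x, y⟫ = ⟪x, A y⟫) (hP : ∀ x y, ⟪P x, y⟫ = ⟪x, P y⟫)
    (hK : K = 1 + τ • (A * P * A)) (hKu : IsUnit K) (x v : V) :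
    τ * ‖x‖ ^ 2 + τ * ‖v‖ ^ 2 + ⟪P (A x + τ • A v), A x + τ • A v⟫ =
      ⟪(A * P * A + τ • (1 : V →L[ℝ] V) - τ • (A * P * A * Ring.inverse K * (A * P * A))) x, x⟫
      + τ * ⟪K (v + Ring.inverse K ((A * P * A) x)), v + Ring.inverse K ((A * P * A) x)⟫ := by
  obtain ⟨H, hH⟩ : ∃ H, H = A * P * A := ⟨_, rfl⟩
  have hHs : ∀ x y, ⟪H x, y⟫ = ⟪x, H y⟫ := by
    intro x y
    simp only [hH, mul_apply_eq_comp]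
    rw [hA, hP, hA]
  obtain ⟨w, hw⟩ : ∃ w, w = Ring.inverse K (H x) := ⟨_, rfl⟩
  -- The left-hand side is quadratic in `v` with leading form `τ K` and mixed term `2 τ ⟪H x, v⟫`,
  -- so `-w` is its critical point.
  have hKw : K w = H x := by
    rw [hw, ← mul_apply_eq_comp, Ring.mul_inverse_cancel _ hKu,
      one_apply_eq_self]
  have e1 : ⟪P (A x + τ • A v), A x + τ • A v⟫ = ⟪H (x + τ • v), x + τ • v⟫ := by
    rw [hH]
    simp only [mul_apply_eq_comp]
    rw [hA, map_add A, map_smul A]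
  have hKs : ∀ x y, ⟪K x, y⟫ = ⟪x, K y⟫ := by
    intro x y
    simp only [hK, ← hH, add_apply, one_apply_eq_self,
      smul_apply, inner_add_left, inner_add_right, real_inner_smul_left,
      real_inner_smul_right, hHs]
  have e2 : ⟪(H + τ • (1 : V →L[ℝ] V) - τ • (H * Ring.inverse K * H)) x, x⟫ =
      ⟪H x, x⟫ + τ * ‖x‖ ^ 2 - τ * ⟪H w, x⟫ := by
    simp only [add_apply, sub_apply,
      one_apply_eq_self, smul_apply,
      mul_apply_eq_comp, ← hw, inner_add_left, inner_sub_left, real_inner_smul_left,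
      real_inner_self_eq_norm_sq]
  have e3 : ⟪K v, v⟫ = ‖v‖ ^ 2 + τ * ⟪H v, v⟫ := by
    simp only [hK, ← hH, add_apply, one_apply_eq_self,
      smul_apply, inner_add_left, real_inner_smul_left,
      real_inner_self_eq_norm_sq]
  rw [← hH, e1, e2, ← hw, map_add K, inner_add_left (K v), inner_add_right (K v), inner_add_right (K w), e3, hKw,
    hKs v w, hKw, map_add H, map_smul H, inner_add_left, inner_add_right, inner_add_right,
    real_inner_smul_left, real_inner_smul_right, real_inner_smul_left, real_inner_smul_right,
    hHs v x, real_inner_comm (H x) v, hHs w x, real_inner_comm (H x) w]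
  ring

section Generic

/-- Spectral theorem for `-A`; testing coercivity on unit eigenvectors bounds the eigenvalues. -/
theorem exists_eq_neg_diag_of_coercive {V W : Type*} [NormedAddCommGroup V]
    [InnerProductSpace ℝ V] [FiniteDimensional ℝ V] [CompleteSpace V] [NormedAddCommGroup W]
    [InnerProductSpace ℝ W] [CompleteSpace W] {A : V →L[ℝ] V} (G : V →L[ℝ] W) {s c : ℝ}
    (hA : A = -((ContinuousLinearMap.adjoint G).comp G) + s • 1)
    (hc : ∀ x, c * ‖x‖ ^ 2 ≤ ‖G x‖ ^ 2 - s * ‖x‖ ^ 2) :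
    ∃ (b : OrthonormalBasis (Fin (Module.finrank ℝ V)) ℝ V) (f : Fin (Module.finrank ℝ V) → ℝ),
      A = -b.diag f ∧ ∀ i, c ≤ f i := by
  have hinner : ∀ x y, ⟪x, (-A) y⟫ = ⟪G x, G y⟫ - s * ⟪x, y⟫ := by
    intro x y
    simp only [hA, neg_apply, add_apply, smul_apply, one_apply_eq_self,
      ContinuousLinearMap.comp_apply, inner_neg_right, inner_add_right, real_inner_smul_right,
      ContinuousLinearMap.adjoint_inner_right]
    ring
  have hsymm : ((-A : V →L[ℝ] V) : V →ₗ[ℝ] V).IsSymmetric := by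
    intro x y
    rw [ContinuousLinearMap.coe_coe, hinner, real_inner_comm, hinner, real_inner_comm (G x),
      real_inner_comm x]
  obtain ⟨b, f, hf⟩ := exists_orthonormalBasis_eq_diag hsymm
  refine ⟨b, f, by rw [← hf, neg_neg], fun i => ?_⟩
  have h1 := hinner (b i) (b i)
  rw [hf, b.inner_diag, real_inner_self_eq_norm_sq, real_inner_self_eq_norm_sq, b.norm_eq_one] at h1
  have h2 := hc (b i)
  rw [b.norm_eq_one] at h2
  linarith

/-! ### Reduction of both Riccati equations to eigenvalues -/

section Diagonal

variable {V ι : Type*} [NormedAddCommGroup V] [InnerProductSpace ℝ V] [Fintype ι]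
  {b : OrthonormalBasis ι ℝ V} {f : ι → ℝ} {α τ : ℝ} {A R : V →L[ℝ] V} (hA : A = -b.diag f)

include hA in
theorem one_sub_smul_eq_diag : 1 - τ • A = b.diag (fun i => 1 + τ * f i) := by
  rw [hA, smul_neg, sub_neg_eq_add, ← b.diag_one, ← map_smul, ← map_add]
  rfl

variable (hf : ∀ i, 0 < f i)
include hA hf

theorem isUnit_one_sub_smul (hτ : 0 < τ) : IsUnit (1 - τ • A) := by
  rw [one_sub_smul_eq_diag hA]
  exact b.isUnit_diag fun i => by have := hf i; positivity

theorem inverse_one_sub_smul_eq_diag (hτ : 0 < τ) :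
    Ring.inverse (1 - τ • A) = b.diag (fun i => 1 + τ * f i)⁻¹ := by
  rw [one_sub_smul_eq_diag hA]
  exact b.inverse_diag fun i => by have := hf i; positivity

variable (hR : R = Ring.inverse (1 - τ • A))
include hR

theorem resolvent_conj_diag (hτ : 0 < τ) (g : ι → ℝ) :
    R * b.diag g * R = b.diag (fun i => ((1 + τ * f i) ^ 2)⁻¹ * g i) := by
  rw [hR, inverse_one_sub_smul_eq_diag hA hf hτ, ← b.diag_mul, ← b.diag_mul]
  congr 1
  ext i
  simp only [Pi.mul_apply, Pi.inv_apply]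
  rw [sq, mul_inv]
  ring

theorem one_add_smul_resolvent_conj_diag (hτ : 0 < τ) (g : ι → ℝ) :
    1 + τ • (R * b.diag g * R) = b.diag (fun i => 1 + τ * (((1 + τ * f i) ^ 2)⁻¹ * g i)) := by
  rw [resolvent_conj_diag hA hf hR hτ, ← b.diag_one, ← map_smul, ← map_add]
  rfl

theorem isUnit_one_add_smul_resolvent_conj_diag (hτ : 0 < τ) {g : ι → ℝ} (hg : ∀ i, 0 ≤ g i) :
    IsUnit (1 + τ • (R * b.diag g * R)) := by
  rw [one_add_smul_resolvent_conj_diag hA hf hR hτ]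
  exact b.isUnit_diag fun i => by have := hf i; have := hg i; positivity

/-- One step of the difference Riccati equation, on diagonal operators. -/
theorem riccati_rhs_eq_diag (hτ : 0 < τ) {g : ι → ℝ} (hg : ∀ i, 0 ≤ g i) :
    R * b.diag g * R + τ • 1
      - τ • (R * b.diag g * R * Ring.inverse (1 + τ • (R * b.diag g * R)) * (R * b.diag g * R)) =
    b.diag (fun i => riccatiStep τ (f i) (g i)) := by
  rw [one_add_smul_resolvent_conj_diag hA hf hR hτ, resolvent_conj_diag hA hf hR hτ,
    b.inverse_diag (fun i => by have := hf i; have := hg i; positivity), ← b.diag_mul,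
    ← b.diag_mul, ← b.diag_one, ← map_smul, ← map_smul, ← map_add, ← map_sub]
  congr 1
  ext i
  have := hf i
  have := hg i
  simp only [Pi.add_apply, Pi.sub_apply, Pi.smul_apply, Pi.mul_apply, Pi.inv_apply, Pi.one_apply,
    smul_eq_mul, riccatiStep]
  have : 0 ≤ ((1 + τ * f i) ^ 2)⁻¹ * g i := by positivity
  -- The rest is `y - τ y² / (1 + τ y) = y / (1 + τ y)`.
  generalize ((1 + τ * f i) ^ 2)⁻¹ * g i = y at *
  have : 1 + τ * y ≠ 0 := by positivity
  field_simp
  ring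

/-- The entries stay nonnegative along the backward induction, so each `Ring.inverse` met is a
genuine inverse and not the default value `0`. -/
theorem differenceRiccati_eq_diag (hτ : 0 < τ) (hα : 0 ≤ α) {N : ℕ} {P : ℕ → V →L[ℝ] V}
    (hP : ∀ n < N, P n = R * P (n + 1) * R + τ • 1 - τ • (R * P (n + 1) * R *
      Ring.inverse (1 + τ • (R * P (n + 1) * R)) * (R * P (n + 1) * R)))
    (hPN : P N = α • 1) {n : ℕ} (hn : n ≤ N) :
    P n = b.diag (fun i => (riccatiStep τ (f i))^[N - n] α) := by
  induction hn using Nat.decreasingInduction with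
  | self => simpa [b.diag_const] using hPN
  | of_succ n hn ih =>
    rw [hP n hn, ih, riccati_rhs_eq_diag hA hf hR hτ
      (fun i => riccatiStep_iterate_nonneg hτ (hf i) hα _)]
    congr 1
    ext i
    rw [show N - n = N - (n + 1) + 1 by omega, Function.iterate_succ_apply']

theorem isUnit_of_differenceRiccati (hτ : 0 < τ) (hα : 0 ≤ α) {N : ℕ} {P : ℕ → V →L[ℝ] V}
    (hP : ∀ n < N, P n = R * P (n + 1) * R + τ • 1 - τ • (R * P (n + 1) * R *
      Ring.inverse (1 + τ • (R * P (n + 1) * R)) * (R * P (n + 1) * R)))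
    (hPN : P N = α • 1) {n : ℕ} (hn : n < N) : IsUnit (1 + τ • (R * P (n + 1) * R)) := by
  rw [differenceRiccati_eq_diag hA hf hR hτ hα hP hPN hn]
  exact isUnit_one_add_smul_resolvent_conj_diag hA hf hR hτ
    fun i => riccatiStep_iterate_nonneg hτ (hf i) hα _

theorem exists_differenceRiccati (hτ : 0 < τ) (hα : 0 ≤ α) (N : ℕ) :
    ∃ P : ℕ → V →L[ℝ] V, (∀ n < N, P n = R * P (n + 1) * R + τ • 1 - τ • (R * P (n + 1) * R *
      Ring.inverse (1 + τ • (R * P (n + 1) * R)) * (R * P (n + 1) * R))) ∧ P N = α • 1 := by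
  refine ⟨fun n => b.diag (fun i => (riccatiStep τ (f i))^[N - n] α), fun n hn => ?_, ?_⟩
  · rw [riccati_rhs_eq_diag hA hf hR hτ (fun i => riccatiStep_iterate_nonneg hτ (hf i) hα _)]
    refine congrArg b.diag (funext fun i => ?_)
    rw [show N - n = N - (n + 1) + 1 by omega, Function.iterate_succ_apply']
  · simp [b.diag_const]

omit hR

theorem riccati_eq_diag (hα : 0 ≤ α) {T : ℝ} {P : ℝ → V →L[ℝ] V}
    (hP : ∀ t ∈ Set.Icc 0 T, HasDerivWithinAt P (-(A * P t + P t * A + 1 - P t ^ 2))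
      (Set.Icc 0 T) t) (hPT : P T = α • 1) {t : ℝ} (ht : t ∈ Set.Icc 0 T) :
    P t = b.diag (fun i => scalarRiccati (f i) α (T - t)) := by
  refine riccati_ode_unique (Q := fun t => b.diag (fun i => scalarRiccati (f i) α (T - t)))
    A hP (fun t ht => ?_) ?_ ht
  · have hq : ∀ i, HasDerivWithinAt (fun t => scalarRiccati (f i) α (T - t))
        (-(1 - 2 * f i * scalarRiccati (f i) α (T - t) - scalarRiccati (f i) α (T - t) ^ 2))
        (Set.Icc 0 T) t := by
      intro i
      have h1 := hasDerivAt_scalarRiccati (hf i).le hα (s := T - t) (by linarith [ht.2])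
      have h2 : HasDerivAt (fun t : ℝ => T - t) (-1) t := by
        simpa using (hasDerivAt_id t).const_sub T
      exact ((h1.comp t h2).congr_deriv (by ring)).hasDerivWithinAt
    refine (b.hasDerivWithinAt_diag hq).congr_deriv ?_
    rw [hA, ← map_neg, ← b.diag_one, sq, ← b.diag_mul, ← b.diag_mul, ← b.diag_mul, ← map_add,
      ← map_add, ← map_sub, ← map_neg]
    congr 1
    ext i
    simp only [Pi.add_apply, Pi.sub_apply, Pi.neg_apply, Pi.mul_apply, Pi.one_apply]
    ring
  · rw [hPT]
    simp [scalarRiccati_zero, b.diag_const]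

end Diagonal

/-! ### The discrete control problem -/

section LQ

variable {E : Type*} [NormedAddCommGroup E] [InnerProductSpace ℝ E] {S : Submodule ℝ E}
  [S.HasOrthogonalProjection]

theorem inner_coe_orthogonalProjectionOnto (x : S) (z : E) :
    ⟪(x : E), z⟫ = ⟪x, S.orthogonalProjectionOnto z⟫ := by
  rw [Submodule.inner_orthogonalProjectionOnto_eq_of_mem_left]

/-- Pythagoras. Controls range over `E` while states see only their projection, so the component of
`u` orthogonal to `S` is pure extra cost. -/
theorem norm_add_coe_sq (u : E) (w : S) :
    ‖u + w‖ ^ 2 = ‖u‖ ^ 2 - ‖S.orthogonalProjectionOnto u‖ ^ 2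
      + ‖S.orthogonalProjectionOnto u + w‖ ^ 2 := by
  rw [norm_add_sq_real, norm_add_sq_real, real_inner_comm, inner_coe_orthogonalProjectionOnto,
    real_inner_comm (S.orthogonalProjectionOnto u) w, Submodule.coe_norm w]
  ring

/-- The feedback operator `K⁻¹ R P R`, `K = 1 + τ R P R`. -/
noncomputable def feedback (R P : S →L[ℝ] S) (τ : ℝ) (x : S) : S :=
  Ring.inverse (1 + τ • (R * P * R)) ((R * P * R) x)

/-- The excess cost of using the control `u` instead of the optimal feedback. -/
noncomputable def excess (R P : S →L[ℝ] S) (τ : ℝ) (x : S) (u : E) : ℝ :=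
  ‖u‖ ^ 2 - ‖S.orthogonalProjectionOnto u‖ ^ 2
    + ⟪(1 + τ • (R * P * R)) (S.orthogonalProjectionOnto u + feedback R P τ x),
      S.orthogonalProjectionOnto u + feedback R P τ x⟫

theorem excess_eq_zero {R P : S →L[ℝ] S} {τ : ℝ} {x : S} {u : E}
    (hu : u = ((-feedback R P τ x : S) : E)) : excess R P τ x u = 0 := by
  rw [excess, hu, Submodule.orthogonalProjectionOnto_mem_subspace_eq_self, neg_add_cancel,
    map_zero, inner_zero_left, add_zero, ← Submodule.coe_norm, sub_self]

theorem norm_add_feedback_sq_le_excess {R P : S →L[ℝ] S} {τ : ℝ} (hτ : 0 < τ)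
    (hR : ∀ x y, ⟪R x, y⟫ = ⟪x, R y⟫) (hP : P.IsPositive) (x : S) (u : E) :
    ‖u + feedback R P τ x‖ ^ 2 ≤ excess R P τ x u := by
  rw [norm_add_coe_sq, excess]
  gcongr
  generalize S.orthogonalProjectionOnto u + feedback R P τ x = y
  have h1 := hP.inner_nonneg_left (R y)
  rw [← hR] at h1
  simp only [add_apply, one_apply_eq_self, smul_apply, mul_apply_eq_comp, inner_add_left,
    real_inner_smul_left, real_inner_self_eq_norm_sq]
  have := mul_nonneg hτ.le h1
  linarith

/-- The closed-loop state, counted from the initial index `l`. -/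
noncomputable def closedLoop (R : S →L[ℝ] S) (P : ℕ → S →L[ℝ] S) (τ : ℝ) (l : ℕ) (z : E) : ℕ → S
  | 0 => S.orthogonalProjectionOnto z
  | k + 1 => R (closedLoop R P τ l z k)
      + τ • R (-feedback R (P (l + k + 1)) τ (closedLoop R P τ l z k))

variable {R : S →L[ℝ] S} {P : ℕ → S →L[ℝ] S} {α τ : ℝ} {N l : ℕ} {z : E}
  {x : (ℕ → E) → ℕ → S}
  (hx0 : ∀ u, x u l = S.orthogonalProjectionOnto z)
  (hx : ∀ u n, l ≤ n → x u (n + 1) = R (x u n) + τ • R (S.orthogonalProjectionOnto (u n)))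

include hx0 hx in
-- Under the feedback law the state depends on `z` alone; this yields uniqueness of the optimal
-- control.
theorem state_eq_closedLoop {u : ℕ → E}
    (hu : ∀ n ∈ Finset.Ico l N, u n = ((-feedback R (P (n + 1)) τ (x u n) : S) : E))
    {n : ℕ} (hl : l ≤ n) (hn : n ≤ N) : x u n = closedLoop R P τ l z (n - l) := by
  induction n, hl using Nat.le_induction with
  | base => rw [hx0, Nat.sub_self, closedLoop]
  | succ n hl ih =>
    rw [hx u n hl, hu n (Finset.mem_Ico.2 ⟨hl, hn⟩),
      Submodule.orthogonalProjectionOnto_mem_subspace_eq_self, ih (by omega),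
      Nat.succ_sub hl, closedLoop, Nat.add_sub_cancel' hl]

include hx0 hx in
-- The open-loop control read off from the closed loop reproduces it, which provides a minimizer.
theorem state_closedLoop {n : ℕ} (hl : l ≤ n) :
    x (fun n => ((-feedback R (P (n + 1)) τ (closedLoop R P τ l z (n - l)) : S) : E)) n
      = closedLoop R P τ l z (n - l) := by
  induction n, hl using Nat.le_induction with
  | base => rw [hx0, Nat.sub_self, closedLoop]
  | succ n hl ih =>
    rw [hx _ n hl, Submodule.orthogonalProjectionOnto_mem_subspace_eq_self, ih,
      Nat.succ_sub hl, closedLoop, Nat.add_sub_cancel' hl]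

variable (hR : ∀ x y, ⟪R x, y⟫ = ⟪x, R y⟫)
  (hP : ∀ n < N, P n = R * P (n + 1) * R + τ • 1 - τ • (R * P (n + 1) * R *
    Ring.inverse (1 + τ • (R * P (n + 1) * R)) * (R * P (n + 1) * R)))
  (hPN : P N = α • 1) (hpos : ∀ n ≤ N, (P n).IsPositive)
  (hK : ∀ n < N, IsUnit (1 + τ • (R * P (n + 1) * R)))
  {cost : (ℕ → E) → ℝ}
  (hcost : ∀ u, cost u = 1 / 2 * (τ * ∑ n ∈ Finset.Ico l N, ‖x u n‖ ^ 2
    + τ * ∑ n ∈ Finset.Ico l N, ‖u n‖ ^ 2) + α / 2 * ‖x u N‖ ^ 2)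

include hx0 hx hR hP hPN hpos hK hcost

/-- The completed squares telescope, and the terminal cost is the quadratic form of `P N = α • 1`.
-/
theorem cost_eq_add_excess (hl : l < N) (u : ℕ → E) :
    cost u = 1 / 2 * ⟪P l (S.orthogonalProjectionOnto z), S.orthogonalProjectionOnto z⟫
      + τ / 2 * ∑ n ∈ Finset.Ico l N, excess R (P (n + 1)) τ (x u n) (u n) := by
  have key : ∀ M, l ≤ M → M ≤ N →
      τ * ∑ n ∈ Finset.Ico l M, ‖x u n‖ ^ 2 + τ * ∑ n ∈ Finset.Ico l M, ‖u n‖ ^ 2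
        + ⟪P M (x u M), x u M⟫ =
      ⟪P l (S.orthogonalProjectionOnto z), S.orthogonalProjectionOnto z⟫
        + τ * ∑ n ∈ Finset.Ico l M, excess R (P (n + 1)) τ (x u n) (u n) := by
    intro M hM
    induction M, hM using Nat.le_induction with
    | base => intro _; simp [hx0]
    | succ M hM ih =>
      intro hMN
      have h1 := ih (by omega)
      have h2 := inner_step_completing_square hR
        (fun x y => (hpos (M + 1) hMN).isSymmetric x y) rfl (hK M (by omega))
        (x u M) (S.orthogonalProjectionOnto (u M))
      rw [← hP M (by omega)] at h2
      rw [hx u M hM, Finset.sum_Ico_succ_top hM, Finset.sum_Ico_succ_top hM,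
        Finset.sum_Ico_succ_top hM, excess, feedback]
      linear_combination h1 + h2
  have h1 := key N hl.le le_rfl
  rw [hPN, smul_apply, one_apply_eq_self, real_inner_smul_left, real_inner_self_eq_norm_sq] at h1
  rw [hcost]
  linear_combination h1 / 2

/-- The discrete linear-quadratic problem is solved by the feedback law, and its value is given
by the difference Riccati equation. -/
theorem discreteLQ_solution (hτ : 0 < τ) (hl : l < N) :
    (∃ u, ∀ v, cost u ≤ cost v) ∧
    (∀ u, (∀ v, cost u ≤ cost v) →
      (∀ v, (∀ w, cost v ≤ cost w) → ∀ n ∈ Finset.Ico l N, v n = u n) ∧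
      ∀ n ∈ Finset.Ico l N, u n = ((-feedback R (P (n + 1)) τ (x u n) : S) : E)) ∧
    ⨅ u, cost u = 1 / 2 * ⟪((P l (S.orthogonalProjectionOnto z) : S) : E), z⟫ := by
  have hcost' := cost_eq_add_excess hx0 hx hR hP hPN hpos hK hcost hl
  have hex : ∀ u, ∀ n ∈ Finset.Ico l N,
      ‖u n + feedback R (P (n + 1)) τ (x u n)‖ ^ 2 ≤ excess R (P (n + 1)) τ (x u n) (u n) :=
    fun u n hn => norm_add_feedback_sq_le_excess hτ hR (hpos _ (Finset.mem_Ico.1 hn).2) _ _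
  rw [inner_coe_orthogonalProjectionOnto]
  obtain ⟨m, hm⟩ : ∃ m, m = 1 / 2 *
    ⟪P l (S.orthogonalProjectionOnto z), S.orthogonalProjectionOnto z⟫ := ⟨_, rfl⟩
  rw [← hm] at hcost' ⊢
  have hlow : ∀ u, m ≤ cost u := by
    intro u
    rw [hcost']
    have : 0 ≤ ∑ n ∈ Finset.Ico l N, excess R (P (n + 1)) τ (x u n) (u n) :=
      Finset.sum_nonneg fun n hn => (sq_nonneg _).trans (hex u n hn)
    have := mul_nonneg (half_pos hτ).le this
    linarith
  obtain ⟨us, hus⟩ : ∃ us, cost us = m := by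
    refine ⟨fun n => ((-feedback R (P (n + 1)) τ (closedLoop R P τ l z (n - l)) : S) : E), ?_⟩
    rw [hcost', Finset.sum_eq_zero, mul_zero, add_zero]
    intro n hn
    apply excess_eq_zero
    rw [state_closedLoop hx0 hx (Finset.mem_Ico.1 hn).1]
  -- A minimizer has total excess at most zero, and each summand dominates a squared distance to the
  -- feedback law.
  have hfeed : ∀ u, (∀ v, cost u ≤ cost v) → ∀ n ∈ Finset.Ico l N,
      u n = ((-feedback R (P (n + 1)) τ (x u n) : S) : E) := by
    intro u hu n hn
    have h1 := hu us
    rw [hus, hcost' u] at h1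
    have h2 : excess R (P (n + 1)) τ (x u n) (u n) ≤
        ∑ n ∈ Finset.Ico l N, excess R (P (n + 1)) τ (x u n) (u n) :=
      Finset.single_le_sum (f := fun n => excess R (P (n + 1)) τ (x u n) (u n))
        (fun n hn => (sq_nonneg _).trans (hex u n hn)) hn
    have h3 : ‖u n + feedback R (P (n + 1)) τ (x u n)‖ ^ 2 ≤ 0 := by
      refine (hex u n hn).trans (h2.trans ?_)
      have h4 : τ / 2 * ∑ n ∈ Finset.Ico l N, excess R (P (n + 1)) τ (x u n) (u n) ≤ 0 := by
        linarith
      exact nonpos_of_mul_nonpos_right h4 (half_pos hτ)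
    have h5 := norm_eq_zero.1 ((pow_eq_zero_iff two_ne_zero).1 (le_antisymm h3 (sq_nonneg _)))
    rw [Submodule.coe_neg]
    exact eq_neg_of_add_eq_zero_left h5
  refine ⟨⟨us, fun v => hus.trans_le (hlow v)⟩, fun u hu => ⟨fun v hv n hn => ?_, hfeed u hu⟩, ?_⟩
  · obtain ⟨hn1, hn2⟩ := Finset.mem_Ico.1 hn
    rw [hfeed u hu n hn, hfeed v hv n hn, state_eq_closedLoop hx0 hx (hfeed u hu) hn1 hn2.le,
      state_eq_closedLoop hx0 hx (hfeed v hv) hn1 hn2.le]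
  · rw [← hus]
    refine le_antisymm (ciInf_le ⟨m, ?_⟩ us) (le_ciInf fun v => hus.trans_le (hlow v))
    rintro _ ⟨v, rfl⟩
    exact hlow v

end LQ

theorem norm_subtypeL_comp_comp_orthogonalProjectionOnto_sub_le {E ι : Type*} [Fintype ι] [NormedAddCommGroup E]
    [InnerProductSpace ℝ E] {S : Submodule ℝ E} [S.HasOrthogonalProjection] {X Y : S →L[ℝ] S}
    {b : OrthonormalBasis ι ℝ S} {f g : ι → ℝ} (hX : X = b.diag f) (hY : Y = b.diag g) {M : ℝ}
    (hM : 0 ≤ M) (hfg : ∀ i, |f i - g i| ≤ M) :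
    ‖S.subtypeL ∘L (X ∘L S.orthogonalProjectionOnto)
      - S.subtypeL ∘L (Y ∘L S.orthogonalProjectionOnto)‖ ≤ M := by
  have hcomp : S.subtypeL ∘L (X ∘L S.orthogonalProjectionOnto)
      - S.subtypeL ∘L (Y ∘L S.orthogonalProjectionOnto) =
      S.subtypeL ∘L ((X - Y) ∘L S.orthogonalProjectionOnto) := by
    ext1 x
    simp
  rw [hcomp]
  have hXY : ‖X - Y‖ ≤ M := by
    rw [hX, hY, ← map_sub]
    exact b.norm_diag_le hM hfg
  calc _ ≤ 1 * (M * 1) := by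
        refine (ContinuousLinearMap.opNorm_comp_le _ _).trans ?_
        gcongr
        · exact Submodule.norm_subtypeL_le _
        · refine (ContinuousLinearMap.opNorm_comp_le _ _).trans ?_
          gcongr
          exact Submodule.orthogonalProjectionOnto_norm_le _
    _ = _ := by ring

end Generic

/-! ### Application to the finite element space -/

section FiniteElements

variable {d : ℕ} {D : Set (Euc d)} {h : ℝ} (𝒯 : Triangulation D h)

/-- The coercivity assumption bounds the eigenvalues of `-𝒜_h` from below, uniformly in the
triangulation. -/
theorem exists_shiftedLaplacian_eq_neg_diag {β c : ℝ}
    (hc : ∀ φ : (gradD D).domain,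
      c * ‖(φ : L2 D)‖ ^ 2 ≤ ‖gradD D φ‖ ^ 2 - β ^ 2 / 2 * ‖(φ : L2 D)‖ ^ 2) :
    ∃ (b : OrthonormalBasis (Fin (Module.finrank ℝ (femSpace 𝒯))) ℝ (femSpace 𝒯))
      (f : Fin (Module.finrank ℝ (femSpace 𝒯)) → ℝ),
      shiftedLaplacian 𝒯 β = -b.diag f ∧ ∀ i, c ≤ f i :=
  exists_eq_neg_diag_of_coercive (gradh 𝒯) rfl fun x => hc ⟨x, x.2.1⟩

theorem dstate_self (β τ : ℝ) (l : ℕ) (z : L2 D) (u : ℕ → L2 D) :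
    dstate 𝒯 β τ l z u l = projh 𝒯 z := by
  rw [dstate, Nat.sub_self, dstateFrom]

theorem dstate_succ (β τ : ℝ) {l n : ℕ} (hn : l ≤ n) (z : L2 D) (u : ℕ → L2 D) :
    dstate 𝒯 β τ l z u (n + 1) = resolvent₀ 𝒯 β τ (dstate 𝒯 β τ l z u n)
      + τ • resolvent₀ 𝒯 β τ (projh 𝒯 (u n)) := by
  rw [dstate, dstate, Nat.succ_sub hn, dstateFrom, Nat.add_sub_cancel' hn]

variable {𝒯}

theorem resolvent₀_symm {β τ : ℝ} {ι : Type*} [Fintype ι]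
    {b : OrthonormalBasis ι ℝ (femSpace 𝒯)} {f : ι → ℝ} (hA : shiftedLaplacian 𝒯 β = -b.diag f)
    (hf : ∀ i, 0 < f i) (hτ : 0 < τ) (x y : femSpace 𝒯) :
    ⟪resolvent₀ 𝒯 β τ x, y⟫ = ⟪x, resolvent₀ 𝒯 β τ y⟫ := by
  have h : resolvent₀ 𝒯 β τ = b.diag (fun i => 1 + τ * f i)⁻¹ :=
    inverse_one_sub_smul_eq_diag hA hf hτ
  rw [h]
  refine (b.isPositive_diag fun i => ?_).isSymmetric x y
  have := hf i
  rw [Pi.inv_apply]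
  positivity

theorem IsDifferenceRiccatiSolution.eq_diag {α β τ : ℝ} {ι : Type*} [Fintype ι]
    {b : OrthonormalBasis ι ℝ (femSpace 𝒯)} {f : ι → ℝ} (hA : shiftedLaplacian 𝒯 β = -b.diag f)
    (hf : ∀ i, 0 < f i) (hτ : 0 < τ) (hα : 0 ≤ α) {N : ℕ}
    {P : ℕ → femSpace 𝒯 →L[ℝ] femSpace 𝒯} (hP : IsDifferenceRiccatiSolution 𝒯 α β τ N P)
    {n : ℕ} (hn : n ≤ N) : P n = b.diag (fun i => (riccatiStep τ (f i))^[N - n] α) :=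
  differenceRiccati_eq_diag hA hf (R := resolvent₀ 𝒯 β τ) rfl hτ hα hP.1 hP.2 hn

theorem IsRiccatiSolution.eq_diag {T α β : ℝ} {ι : Type*} [Fintype ι]
    {b : OrthonormalBasis ι ℝ (femSpace 𝒯)} {f : ι → ℝ} (hA : shiftedLaplacian 𝒯 β = -b.diag f)
    (hf : ∀ i, 0 < f i) (hα : 0 ≤ α) {P : ℝ → femSpace 𝒯 →L[ℝ] femSpace 𝒯}
    (hP : IsRiccatiSolution 𝒯 T α β P) {t : ℝ} (ht : t ∈ Icc 0 T) :
    P t = b.diag (fun i => scalarRiccati (f i) α (T - t)) :=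
  riccati_eq_diag hA hf hα hP.1 hP.2 ht

theorem isUnit_opK {α β τ : ℝ} {ι : Type*} [Fintype ι]
    {b : OrthonormalBasis ι ℝ (femSpace 𝒯)} {f : ι → ℝ} (hA : shiftedLaplacian 𝒯 β = -b.diag f)
    (hf : ∀ i, 0 < f i) (hτ : 0 < τ) (hα : 0 ≤ α) {N : ℕ}
    {P : ℕ → femSpace 𝒯 →L[ℝ] femSpace 𝒯} (hP : IsDifferenceRiccatiSolution 𝒯 α β τ N P)
    {n : ℕ} (hn : n < N) : IsUnit (opK 𝒯 β τ P n) :=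
  isUnit_of_differenceRiccati hA hf (R := resolvent₀ 𝒯 β τ) rfl hτ hα hP.1 hP.2 hn

end FiniteElements

set_option maxHeartbeats 1000000 in
theorem mainTheorem6 (d : ℕ) (hd : 1 ≤ d ∧ d ≤ 3) (D : Set (Euc d)) (hD : IsBoundedDomain D)
    (hD' : HasSmoothBoundary D ∨ IsConvexPolyhedral D)
    (T α β τ₀ : ℝ) (hT : 0 < T) (hα : 0 ≤ α) (hτ₀ : 0 < τ₀ ∧ τ₀ < 1)
    (hH : AssumptionH D β) :
    -- the difference Riccati equation is well posed, takes values in the symmetric nonnegative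
    -- operators and is the Riccati equation of the discretized LQ problem
    (∀ (h : ℝ) (𝒯 : Triangulation D h) (N : ℕ), 0 < N → ∀ τ : ℝ, τ = T / N →
      IsUnit (1 - τ • shiftedLaplacian 𝒯 β) ∧
      (∃ P, IsDifferenceRiccatiSolution 𝒯 α β τ N P) ∧
      ∀ P : ℕ → femSpace 𝒯 →L[ℝ] femSpace 𝒯, IsDifferenceRiccatiSolution 𝒯 α β τ N P →
        (∀ n ≤ N, (P n).IsPositive) ∧
        (∀ n < N, IsUnit (opK 𝒯 β τ P n)) ∧
        ∀ l < N, ∀ z : L2 D,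
          (∃ u : ℕ → L2 D, IsOptimalControl 𝒯 α β τ N l z u) ∧
          (∀ u : ℕ → L2 D, IsOptimalControl 𝒯 α β τ N l z u →
            (∀ v : ℕ → L2 D, IsOptimalControl 𝒯 α β τ N l z v →
              ∀ n ∈ Finset.Ico l N, v n = u n) ∧
            ∀ n ∈ Finset.Ico l N, u n =
              ((-(Ring.inverse (opK 𝒯 β τ P n)
                (opH 𝒯 β τ P n (dstate 𝒯 β τ l z u n))) : femSpace 𝒯) : L2 D)) ∧
          dvalue 𝒯 α β τ N l z = 1 / 2 * ⟪((P l (projh 𝒯 z) : femSpace 𝒯) : L2 D), z⟫) ∧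
    -- the error estimate
    ∃ C : ℝ, 0 < C ∧
      ∀ (h : ℝ) (𝒯 : Triangulation D h) (N : ℕ), 0 < N → ∀ τ : ℝ, τ = T / N → τ ≤ τ₀ →
      ∀ (Ph : ℝ → femSpace 𝒯 →L[ℝ] femSpace 𝒯) (P : ℕ → femSpace 𝒯 →L[ℝ] femSpace 𝒯),
        IsRiccatiSolution 𝒯 T α β Ph → IsDifferenceRiccatiSolution 𝒯 α β τ N P →
        ∀ l < N,
          ‖(femSpace 𝒯).subtypeL ∘L (Ph (l * τ) ∘L projh 𝒯)
            - (femSpace 𝒯).subtypeL ∘L (P l ∘L projh 𝒯)‖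
          ≤ C * τ * (α / (T - l * τ) + Real.log (1 / τ)) := by
  obtain ⟨c, hc, hcoer⟩ := hH
  refine ⟨fun h 𝒯 N hN τ hτN => ?_, ?_⟩
  · have hτ : 0 < τ := by rw [hτN]; positivity
    obtain ⟨b, f, hA, hcf⟩ := exists_shiftedLaplacian_eq_neg_diag 𝒯 hcoer
    have hf : ∀ i, 0 < f i := fun i => hc.trans_le (hcf i)
    refine ⟨isUnit_one_sub_smul hA hf hτ,
      exists_differenceRiccati hA hf (R := resolvent₀ 𝒯 β τ) rfl hτ hα N, fun P hP => ?_⟩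
    have hpos : ∀ n ≤ N, (P n).IsPositive := by
      intro n hn
      rw [hP.eq_diag hA hf hτ hα hn]
      exact b.isPositive_diag fun i => riccatiStep_iterate_nonneg hτ (hf i) hα _
    have hK : ∀ n < N, IsUnit (opK 𝒯 β τ P n) := fun n hn => isUnit_opK hA hf hτ hα hP hn
    exact ⟨hpos, hK, fun l hl z =>
      discreteLQ_solution (fun u => dstate_self 𝒯 β τ l z u)
        (fun u n hn => dstate_succ 𝒯 β τ hn z u) (resolvent₀_symm hA hf hτ) hP.1 hP.2 hpos hK
        (cost := dcost 𝒯 α β τ N l z) (fun u => rfl) hτ hl⟩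
  · obtain ⟨C, hC, hest⟩ := exists_abs_scalarRiccati_sub_iterate_le hc hα
    have hlog0 : 0 < Real.log (1 / τ₀) := Real.log_pos (by
      rw [one_div]; exact (one_lt_inv₀ hτ₀.1).2 hτ₀.2)
    -- For `τ ≤ τ₀` the factor `1 + 1 / log (1 / τ₀)` times `log (1 / τ)` is at least `1`, which
    -- absorbs the bare term `τ` of the scalar bound.
    refine ⟨C * (1 + (Real.log (1 / τ₀))⁻¹), by positivity, ?_⟩
    intro h 𝒯 N hN τ hτN hττ₀ Ph P hPh hP l hl
    have hτ : 0 < τ := by rw [hτN]; positivity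
    obtain ⟨b, f, hA, hcf⟩ := exists_shiftedLaplacian_eq_neg_diag 𝒯 hcoer
    have hf : ∀ i, 0 < f i := fun i => hc.trans_le (hcf i)
    have hk : 0 < N - l := Nat.sub_pos_of_lt hl
    have hkR : (0 : ℝ) < (N - l : ℕ) := by exact_mod_cast hk
    have hNR : (0 : ℝ) < N := by exact_mod_cast hN
    -- The scalar estimate is used with `k = N - l` steps, so `α / k = τ α / (T - t_l)`.
    have hTl : T - l * τ = (N - l : ℕ) * τ := by
      rw [Nat.cast_sub hl.le, hτN]; field_simp
    have hmem : (l * τ : ℝ) ∈ Icc 0 T := by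
      refine ⟨by positivity, ?_⟩
      have : 0 ≤ T - l * τ := by rw [hTl]; positivity
      linarith
    have hlog : Real.log (1 / τ₀) ≤ Real.log (1 / τ) :=
      Real.log_le_log (by have := hτ₀.1; positivity) (one_div_le_one_div_of_le hτ hττ₀)
    have hdiff := norm_subtypeL_comp_comp_orthogonalProjectionOnto_sub_le
      (hPh.eq_diag hA hf hα hmem) (hP.eq_diag hA hf hτ hα hl.le)
      (M := C * (α * ((N - l : ℕ) : ℝ)⁻¹ + τ)) (by positivity) (fun i => by
        rw [hTl]
        exact hest τ (f i) hτ (hττ₀.trans hτ₀.2.le) (hcf i) _ hk)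
    rw [hTl]
    refine hdiff.trans ?_
    have h1 : 1 ≤ (1 + (Real.log (1 / τ₀))⁻¹) * Real.log (1 / τ) := by
      have : 1 ≤ (Real.log (1 / τ₀))⁻¹ * Real.log (1 / τ) := by
        rw [inv_mul_eq_div, one_le_div hlog0]; exact hlog
      linarith
    have h2 : 1 ≤ 1 + (Real.log (1 / τ₀))⁻¹ := by
      have := inv_pos.2 hlog0
      linarith
    calc C * (α * ((N - l : ℕ) : ℝ)⁻¹ + τ)
        = C * τ * (1 * (α / ((N - l : ℕ) * τ)) + 1) := by field_simp
      _ ≤ C * τ * ((1 + (Real.log (1 / τ₀))⁻¹) * (α / ((N - l : ℕ) * τ))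
          + (1 + (Real.log (1 / τ₀))⁻¹) * Real.log (1 / τ)) := by gcongr
      _ = _ := by ring
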